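/- **Setting.** Let $C=(C_{i,j})_{i,j\in I}$ ($I$ finite) be a symmetrizable generalized Cartan matrix, with $r_i\in\mathbb N^*$ such that $B_{i,j}=r_iC_{i,j}$ is symmetric, and let $(\mathfrak h,\{\alpha_i\},\{\alpha_i^\vee\})$ be a realization of $C$ over $\mathbb Q$ ($\dim_{\mathbb Q}\mathfrak h=2|I|-\operatorname{rank}C$, the $\alpha_i\in\mathfrak h^*$ and the $\alpha_i^\vee\in\mathfrak h$ linearly independent, $\alpha_j(\alpha_i^\vee)=C_{i,j}$). Let $q\in\mathbb C^*$ not be a root of unity, with a fixed logarithm defining $q^s$ for $s\in\mathbb Q$, and $q_i=q^{r_i}$. The quantum affinization $\mathcal U_q(\hat{\mathfrak g})$ is the $\mathbb C$-algebra with generators $x^\pm_{i,r}$ ($r\in\mathbb Z$), $k_h$ ($h\in\mathfrak h$), $h_{i,m}$ ($m\in\mathbb Z\setminus\{0\}$) and the following relations, where $x_i^\pm(w)=\sum_r x^\pm_{i,r}w^r$, $\delta(z)=\sum_{r\in\mathbb Z}z^r$ and $\phi_i^\pm(z)=\sum_{m\ge0}\phi^\pm_{i,\pm m}z^{\pm m}=k_{\pm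 r_i\alpha_i^\vee}\exp\bigl(\pm(q-q^{-1})\sum_{m\ge1}h_{i,\pm m}z^{\pm m}\bigr)$: $$k_hk_{h'}=k_{h+h'},\quad k_0=1,\quad k_h\phi_i^\pm(z)=\phi_i^\pm(z)k_h,\quad k_hx_j^\pm(z)=q^{\pm\alpha_j(h)}x_j^\pm(z)k_h,$$ $$\phi_i^{\epsilon}(z)x_j^\pm(w)=\frac{q^{\pm B_{i,j}}w-z}{w-q^{\pm B_{i,j}}z}\,x_j^\pm(w)\phi_i^{\epsilon}(z)\quad(\text{expanded in powers of } z/w \text{ for } \epsilon=+,\ \text{of } w/z \text{ for } \epsilon=-),$$ $$x_i^+(z)x_j^-(w)-x_j^-(w)x_i^+(z)=\frac{\delta_{i,j}}{q_i-q_i^{-1}}\Bigl(\delta\bigl(\tfrac wz\bigr)\phi_i^+(w)-\delta\bigl(\tfrac zw\bigr)\phi_i^-(z)\Bigr),$$ $$(w-q^{\pm B_{i,j}}z)x_i^\pm(z)x_j^\pm(w)=(q^{\pm B_{i,j}}w-z)x_j^\pm(w)x_i^\pm(z),$$ and, for $i\ne j$ and $s=1-C_{i,j}$, $$\sum_{\pi\in\Sigma_s}\sum_{k=0}^{s}(-1)^k\begin{bmatrix}s\\k\end{bmatrix}_{q_i}x_i^\pm(w_{\pi(1)})\cdots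 x_i^\pm(w_{\pi(k)})x_j^\pm(z)x_i^\pm(w_{\pi(k+1)})\cdots x_i^\pm(w_{\pi(s)})=0.$$ Let $\mathcal U_q(\hat{\mathfrak h})$ be the subalgebra generated by the $k_h$ and $h_{i,m}$, and $\mathcal U_q(\mathfrak h)$ the one generated by the $k_h$. Put $\mathcal A=\{f/g : f,g\in\mathbb C[u^{\pm1}],\ g(1)\neq0\}\subset\mathbb C(u)$, $\mathcal U'_q(\hat{\mathfrak g})=\mathcal U_q(\hat{\mathfrak g})\otimes\mathbb C(u)$ and $\mathcal U^u_q(\hat{\mathfrak g})=\mathcal U_q(\hat{\mathfrak g})\otimes\mathcal A\subset\mathcal U'_q(\hat{\mathfrak g})$. Weight spaces are $V_\omega=\{v : k_hv=q^{\omega(h)}v\ \forall h\in\mathfrak h\}$, $\omega\in\mathfrak h^*$. $\mathrm{Mod}(\mathcal U_q(\mathfrak h))$ consists of the $\mathcal U_q(\mathfrak h)$-modules $V=\bigoplus_\omega V_\omega$ such that every $V_\omega$ is finite dimensional, for all $\omega,i$ one has $V_{\omega\pm r\alpha_i}=0$ for $r$ large, and there are $\lambda_1,\dots,\lambda_t\in\mathfrak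 h^*$ such that every weight lies in some $\lambda_j-\sum_i\mathbb N\alpha_i$. $\mathrm{Mod}(\mathcal U_q(\hat{\mathfrak g}))$ consists of the $\mathcal U_q(\hat{\mathfrak g})$-modules whose restriction to $\mathcal U_q(\mathfrak h)$ is in $\mathrm{Mod}(\mathcal U_q(\mathfrak h))$. $\mathrm{Mod}(\mathcal U'_q(\hat{\mathfrak g}))$ consists of the $\mathcal U'_q(\hat{\mathfrak g})$-modules $V$ having a $\mathbb C$-subspace $W$ such that: (i) the multiplication map $W\otimes_{\mathbb C}\mathbb C(u)\to V$ is an isomorphism; (ii) $W$ is $\mathcal U_q(\mathfrak h)$-stable and in $\mathrm{Mod}(\mathcal U_q(\mathfrak h))$; (iii) the image of $W\otimes\mathbb C[u^{\pm1}]$ in $V$ is stable under $\mathcal U_q(\hat{\mathfrak h})$; (iv) for all $\omega\in\mathfrak h^*$, $i\in I$, $r\in\mathbb Z$ and each sign $\pm$ there are finitely many $\mathbb C$-linear maps $f^\pm_{k,k',\lambda}:W_\omega\to V$ ($k,k'\ge0$, $\lambda\in\mathbb C^*$) with $x^\pm_{i,r\pm m}w=\sum\lambda^mu^{km}m^{k'}f^\pm_{k,k',\lambda}(w)$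 for all $m\ge0$, $w\in W_\omega$; and such that (v) $V=\bigoplus V_{(\lambda,\Psi)}$, the sum being over all pairs $(\lambda,\Psi)$ with $\lambda\in\mathfrak h^*$, $\Psi=(\Psi^\pm_{i,\pm m})_{i\in I,m\ge0}$, $\Psi^\pm_{i,\pm m}\in\mathbb C[u^{\pm1}]$, $\Psi^\pm_{i,0}=q_i^{\pm\lambda(\alpha_i^\vee)}$, where $V_{(\lambda,\Psi)}=\{v\in V_\lambda : \exists p\ge 0\ \forall i\in I,\ m\ge0,\ (\phi^\pm_{i,\pm m}-\Psi^\pm_{i,\pm m})^pv=0\}$. An *$\mathcal A$-form* of $V\in\mathrm{Mod}(\mathcal U'_q(\hat{\mathfrak g}))$ is an $\mathcal A$-submodule $\tilde V\subset V$ which is stable under $\mathcal U^u_q(\hat{\mathfrak g})$, spans $V$ over $\mathbb C(u)$, and is such that $\tilde V\cap V_\lambda$ is a finitely generated $\mathcal A$-module for every $\lambda\in\mathfrak h^*$. Its *specialization* is the $\mathcal U_q(\hat{\mathfrak g})$-module $(\tilde V)_{u=1}=\tilde V/(u-1)\tilde V$. **Theorem 4.6.** Let $V\in\mathrm{Mod}(\mathcal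 U'_q(\hat{\mathfrak g}))$ and $v\in V\setminus\{0\}$. Then $\mathcal U'_q(\hat{\mathfrak g}).v$ is an object of $\mathrm{Mod}(\mathcal U'_q(\hat{\mathfrak g}))$ and $\tilde V(v)=\mathcal U^u_q(\hat{\mathfrak g}).v$ is an $\mathcal A$-form of $\mathcal U'_q(\hat{\mathfrak g}).v$. Moreover $(\tilde V(v))_{u=1}$ is an object of $\mathrm{Mod}(\mathcal U_q(\hat{\mathfrak g}))$, is nonzero, and is generated as a $\mathcal U_q(\hat{\mathfrak g})$-module by the image of $v$. -/

import Mathlib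

open scoped TensorProduct BigOperators

noncomputable section

namespace QAff

/-! ## Cartan data -/

/-- A symmetrizable generalized Cartan matrix with a chosen symmetrization, a realization of it
over `ℚ`, and a nonzero complex number `q = exp logq` which is not a root of unity.  The choice of
a logarithm of `q` fixes the rational powers `q ^ s = exp (s * logq)`. -/
structure Datum (I : Type*) [Fintype I] [DecidableEq I]
    (𝔥 : Type*) [AddCommGroup 𝔥] [Module ℚ 𝔥] where
  C : Matrix I I ℤ
  diag : ∀ i, C i i = 2
  offdiag : ∀ i j, i ≠ j → C i j ≤ 0
  zero_iff : ∀ i j, C i j = 0 ↔ C j i = 0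
  r : I → ℕ
  r_pos : ∀ i, 0 < r i
  symm : ∀ i j, (r i : ℤ) * C i j = (r j : ℤ) * C j i
  finite : Module.Finite ℚ 𝔥
  finrank_add : Module.finrank ℚ 𝔥 + (C.map (Int.cast : ℤ → ℚ)).rank = 2 * Fintype.card I
  root : I → Module.Dual ℚ 𝔥
  coroot : I → 𝔥
  root_indep : LinearIndependent ℚ root
  coroot_indep : LinearIndependent ℚ coroot
  root_coroot : ∀ i j, root j (coroot i) = (C i j : ℚ)
  logq : ℂ
  not_root_of_unity : ∀ n : ℕ, 0 < n → Complex.exp logq ^ n ≠ 1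

variable {I : Type*} [Fintype I] [DecidableEq I] {𝔥 : Type*} [AddCommGroup 𝔥] [Module ℚ 𝔥]
  (D : Datum I 𝔥)

/-- The power `q ^ s` for rational `s`. -/
def Datum.qpow (s : ℚ) : ℂ := Complex.exp ((s : ℂ) * D.logq)

/-- The symmetrized Cartan matrix `B = diag(r) C`. -/
def Datum.B (i j : I) : ℤ := (D.r i : ℤ) * D.C i j

/-- `q_i = q ^ (r_i)`. -/
def Datum.qi (i : I) : ℂ := D.qpow (D.r i)

/-- `λ ≥ μ`, that is, `λ - μ` is a sum of simple roots. -/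
def Datum.Dominates (lam mu : Module.Dual ℚ 𝔥) : Prop :=
  ∃ n : I → ℕ, lam - mu = ∑ i, n i • D.root i

/-- The quantum integer `[n]_v`. -/
def qInt (v : ℂ) (n : ℕ) : ℂ := (v ^ n - (v⁻¹) ^ n) / (v - v⁻¹)

/-- The quantum factorial `[n]_v!`. -/
def qFactorial (v : ℂ) (n : ℕ) : ℂ := ∏ k ∈ Finset.range n, qInt v (k + 1)

/-- The quantum binomial coefficient. -/
def qBinom (v : ℂ) (n k : ℕ) : ℂ := qFactorial v n / (qFactorial v k * qFactorial v (n - k))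

/-! ## The quantum affinization

Signs are elements of `ℤˣ`. -/

/-- The generators `k_h`, `x^±_{i,r}`, `h_{i,m}` (`m ≠ 0`). -/
inductive Gen (I : Type*) (𝔥 : Type*)
  | k (h : 𝔥) : Gen I 𝔥
  | x (ε : ℤˣ) (i : I) (r : ℤ) : Gen I 𝔥
  | h (i : I) (m : {m : ℤ // m ≠ 0}) : Gen I 𝔥

section phi
variable {A : Type*} [Ring A] [Algebra ℂ A]

/-- The power series `ε (q - q⁻¹) ∑_{p ≥ 1} h_{i, ε p} t ^ p`. -/
def hSeries (h : I → {m : ℤ // m ≠ 0} → A) (ε : ℤˣ) (i : I) : PowerSeries A :=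
  PowerSeries.mk fun p : ℕ =>
    if hp : p = 0 then 0
    else (((ε : ℤ) : ℂ) * (D.qpow 1 - D.qpow (-1))) •
      h i ⟨(ε : ℤ) * p, mul_ne_zero (Units.ne_zero ε) (by exact_mod_cast hp)⟩

/-- `φ^ε_{i, ε m}` for `m ≥ 0`: the coefficient of `t ^ m` in
`k_{ε r_i α_i^∨} exp (ε (q - q⁻¹) ∑_{p ≥ 1} h_{i, ε p} t ^ p)` (here `t = z ^ ε`).
As the series in the exponential has no constant term, only its powers of exponent at most `m`
contribute to the coefficient of `t ^ m`. -/
def phiNat (k : 𝔥 → A) (h : I → {m : ℤ // m ≠ 0} → A) (ε : ℤˣ) (i : I) (m : ℕ) : A :=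
  k (((ε : ℤ) * (D.r i : ℤ)) • D.coroot i) *
    ∑ n ∈ Finset.range (m + 1),
      ((n.factorial : ℂ)⁻¹) • PowerSeries.coeff m (hSeries D h ε i ^ n)

/-- `φ^ε_{i, m}` for all integers `m`; it vanishes if `m` and `ε` have opposite signs. -/
def phiInt (k : 𝔥 → A) (h : I → {m : ℤ // m ≠ 0} → A) (ε : ℤˣ) (i : I) (m : ℤ) : A :=
  if 0 ≤ (ε : ℤ) * m then phiNat D k h ε i m.natAbs else 0

end phi

/-- The rational function `(c w - z) / (w - c z)`, expanded in powers of `t = z / w`. -/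
def gPlus (c : ℂ) : PowerSeries ℂ :=
  (PowerSeries.C c - PowerSeries.X) * (1 - PowerSeries.C c * PowerSeries.X)⁻¹

/-- The rational function `(c w - z) / (w - c z)`, expanded in powers of `t = w / z`. -/
def gMinus (c : ℂ) : PowerSeries ℂ :=
  (PowerSeries.C c * PowerSeries.X - 1) * (PowerSeries.X - PowerSeries.C c)⁻¹

/-- The free algebra on the generators. -/
abbrev Free (I : Type*) (𝔥 : Type*) := FreeAlgebra ℂ (Gen I 𝔥)

def fk (h : 𝔥) : Free I 𝔥 := FreeAlgebra.ι ℂ (Gen.k h)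
def fx (ε : ℤˣ) (i : I) (r : ℤ) : Free I 𝔥 := FreeAlgebra.ι ℂ (Gen.x ε i r)
def fh (i : I) (m : {m : ℤ // m ≠ 0}) : Free I 𝔥 := FreeAlgebra.ι ℂ (Gen.h i m)
def fphi (ε : ℤˣ) (i : I) (m : ℤ) : Free I 𝔥 := phiInt D fk fh ε i m

/-- The defining relations of the quantum affinization, coefficient by coefficient in the formal
variables of the currents `x^±_i(w) = ∑_r x^±_{i,r} w ^ r`, `φ^±_i(z) = ∑_m φ^±_{i,m} z ^ m`. -/
inductive Rel : Free I 𝔥 → Free I 𝔥 → Prop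
  | k_add (h h' : 𝔥) : Rel (fk h * fk h') (fk (h + h'))
  | k_zero : Rel (fk 0) 1
  | k_phi (h : 𝔥) (ε : ℤˣ) (i : I) (m : ℤ) :
      Rel (fk h * fphi D ε i m) (fphi D ε i m * fk h)
  | k_x (h : 𝔥) (ε : ℤˣ) (j : I) (r : ℤ) :
      Rel (fk h * fx ε j r) (D.qpow (((ε : ℤ) : ℚ) * D.root j h) • (fx ε j r * fk h))
  /-- `φ⁺_i(z) x^ε_j(w) = g (z / w) x^ε_j(w) φ⁺_i(z)`, coefficient of `z ^ m w ^ r`. -/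
  | phi_plus_x (ε : ℤˣ) (i j : I) (m : ℕ) (r : ℤ) :
      Rel (fphi D 1 i m * fx ε j r)
        (∑ p ∈ Finset.range (m + 1),
          PowerSeries.coeff p (gPlus (D.qpow ((ε : ℤ) * D.B i j : ℤ))) •
            (fx ε j (r + p) * fphi D 1 i ((m : ℤ) - p)))
  /-- `φ⁻_i(z) x^ε_j(w) = g (w / z) x^ε_j(w) φ⁻_i(z)`, coefficient of `z ^ (-m) w ^ r`. -/
  | phi_minus_x (ε : ℤˣ) (i j : I) (m : ℕ) (r : ℤ) :
      Rel (fphi D (-1) i (-(m : ℤ)) * fx ε j r)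
        (∑ p ∈ Finset.range (m + 1),
          PowerSeries.coeff p (gMinus (D.qpow ((ε : ℤ) * D.B i j : ℤ))) •
            (fx ε j (r - p) * fphi D (-1) i (-((m : ℤ) - p))))
  | x_plus_x_minus (i j : I) (r s : ℤ) :
      Rel (fx 1 i r * fx (-1) j s - fx (-1) j s * fx 1 i r)
        (if i = j then
          ((D.qi i - (D.qi i)⁻¹)⁻¹) • (fphi D 1 i (r + s) - fphi D (-1) i (r + s)) else 0)
  | x_x (ε : ℤˣ) (i j : I) (r s : ℤ) :
      Rel (fx ε i (r + 1) * fx ε j s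
            - D.qpow ((ε : ℤ) * D.B i j : ℤ) • (fx ε i r * fx ε j (s + 1)))
        (D.qpow ((ε : ℤ) * D.B i j : ℤ) • (fx ε j s * fx ε i (r + 1))
            - fx ε j (s + 1) * fx ε i r)
  /-- The affine quantum Serre relations; here `s = 1 - C i j`. -/
  | serre (ε : ℤˣ) (i j : I) (hij : i ≠ j) (s : ℕ) (hs : (s : ℤ) = 1 - D.C i j)
      (r : Fin s → ℤ) (r' : ℤ) :
      Rel (∑ π : Equiv.Perm (Fin s), ∑ k ∈ Finset.range (s + 1),
            ((-1 : ℂ) ^ k * qBinom (D.qi i) s k) •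
              (((List.ofFn fun a : Fin s => (fx ε i (r (π a)) : Free I 𝔥)).take k).prod
                * fx ε j r' *
                ((List.ofFn fun a : Fin s => (fx ε i (r (π a)) : Free I 𝔥)).drop k).prod))
        0

/-- The quantum affinization `U_q(ĝ)`. -/
def Uq : Type _ := RingQuot (Rel D)

instance : Ring (Uq D) := inferInstanceAs (Ring (RingQuot (Rel D)))
instance : Algebra ℂ (Uq D) := inferInstanceAs (Algebra ℂ (RingQuot (Rel D)))

/-- The projection of the free algebra onto `U_q(ĝ)`. -/
def Uq.proj : Free I 𝔥 →ₐ[ℂ] Uq D := RingQuot.mkAlgHom ℂ (Rel D)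

def Uq.k (h : 𝔥) : Uq D := Uq.proj D (fk h)
def Uq.x (ε : ℤˣ) (i : I) (r : ℤ) : Uq D := Uq.proj D (fx ε i r)
def Uq.h (i : I) (m : {m : ℤ // m ≠ 0}) : Uq D := Uq.proj D (fh i m)
def Uq.phi (ε : ℤˣ) (i : I) (m : ℤ) : Uq D := Uq.proj D (fphi D ε i m)

/-- The subalgebra `U_q(ĥ)` generated by the `k_h` and the `h_{i,m}`. -/
def UqCartan : Subalgebra ℂ (Uq D) :=
  Algebra.adjoin ℂ (Set.range (Uq.k D) ∪ Set.range fun p : I × {m : ℤ // m ≠ 0} => Uq.h D p.1 p.2)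

/-! ## The rings `ℂ(u)`, `ℂ[u, u⁻¹]` and `𝒜`, and scalar extensions of `U_q(ĝ)` -/

/-- The field `ℂ(u)`. -/
abbrev Cu := RatFunc ℂ

/-- The ring of Laurent polynomials `ℂ[u, u⁻¹]` inside `ℂ(u)`. -/
def laurentRing : Subalgebra ℂ Cu := Algebra.adjoin ℂ {RatFunc.X, RatFunc.X⁻¹}

/-- The local ring `𝒜` of the rational functions `f / g` with `g(1) ≠ 0`.  (Since `u` is a unit at
`u = 1`, it makes no difference whether `f, g` are polynomials or Laurent polynomials.) -/
def 𝒜 : Subalgebra ℂ Cu where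
  carrier := {x | ∃ f g : Polynomial ℂ, g.eval 1 ≠ 0 ∧
    x = algebraMap (Polynomial ℂ) Cu f / algebraMap (Polynomial ℂ) Cu g}
  mul_mem' := by
    rintro _ _ ⟨f, g, hg, rfl⟩ ⟨f', g', hg', rfl⟩
    exact ⟨f * f', g * g', by simp [hg, hg'], by rw [map_mul, map_mul, div_mul_div_comm]⟩
  add_mem' := by
    rintro _ _ ⟨f, g, hg, rfl⟩ ⟨f', g', hg', rfl⟩
    have h0 : ∀ p : Polynomial ℂ, p.eval 1 ≠ 0 → algebraMap (Polynomial ℂ) Cu p ≠ 0 := by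
      intro p hp h
      have : p = 0 := (map_eq_zero_iff _ (RatFunc.algebraMap_injective ℂ)).1 h
      simp [this] at hp
    exact ⟨f * g' + g * f', g * g', by simp [hg, hg'],
      by rw [map_add, map_mul, map_mul, map_mul, div_add_div _ _ (h0 g hg) (h0 g' hg')]⟩
  algebraMap_mem' := fun c => ⟨Polynomial.C c, 1, by simp, by
    rw [map_one, div_one]; rfl⟩

/-- `u - 1` as an element of `𝒜`. -/
def uSubOne : 𝒜 :=
  ⟨RatFunc.X - 1, Polynomial.X - 1, 1, by simp, by simp⟩

/-- `U'_q(ĝ) = U_q(ĝ) ⊗ ℂ(u)`. -/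
abbrev UqCu := Cu ⊗[ℂ] Uq D

/-- The inclusion of `U_q(ĝ)` in `U'_q(ĝ)`. -/
def incl : Uq D →ₐ[ℂ] UqCu D := Algebra.TensorProduct.includeRight

/-- `U^u_q(ĝ) = U_q(ĝ) ⊗ 𝒜`, as a subalgebra of `U'_q(ĝ)`. -/
def UqA : Subalgebra ℂ (UqCu D) :=
  (Algebra.TensorProduct.map 𝒜.val (AlgHom.id ℂ (Uq D))).range

lemma incl_mem_UqA (a : Uq D) : incl D a ∈ UqA D := ⟨1 ⊗ₜ a, by simp [incl]⟩

lemma smul_mem_UqA (f : 𝒜) {a : UqCu D} (ha : a ∈ UqA D) : (f : Cu) • a ∈ UqA D := by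
  have hf : algebraMap Cu (UqCu D) (f : Cu) ∈ UqA D :=
    ⟨f ⊗ₜ 1, by simp [Algebra.TensorProduct.algebraMap_apply]⟩
  rw [Algebra.smul_def]
  exact mul_mem hf ha

/-! ## Weights and the category of integrable modules in category `𝒪` -/

section weights

variable {F : Type*} [Field F] [Algebra ℂ F] {M : Type*} [AddCommGroup M] [Module F M]

/-- The weight space of weight `ω`, for a family of operators `κ h` giving the action of
the `k_h`. -/
def weightSpace (κ : 𝔥 → Module.End F M) (ω : Module.Dual ℚ 𝔥) : Submodule F M where
  carrier := {v | ∀ h, κ h v = algebraMap ℂ F (D.qpow (ω h)) • v}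
  zero_mem' := by intro h; simp
  add_mem' := by intro a b ha hb h; rw [map_add, ha h, hb h, smul_add]
  smul_mem' := by intro c a ha h; rw [map_smul, ha h, smul_comm]

end weights

/-- The `ℂ`-subspace `W`, on which the `k_h` act by the operators `κ h`, is a `U_q(𝔥)`-submodule
which is integrable and belongs to the category `𝒪`. -/
structure InModCartan {M : Type*} [AddCommGroup M] [Module ℂ M]
    (κ : 𝔥 → Module.End ℂ M) (W : Submodule ℂ M) : Prop where
  stable : ∀ h, ∀ w ∈ W, κ h w ∈ W
  independent : iSupIndep fun ω => W ⊓ weightSpace D κ ω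
  iSup_eq : ⨆ ω, W ⊓ weightSpace D κ ω = W
  finite : ∀ ω, FiniteDimensional ℂ ↥(W ⊓ weightSpace D κ ω)
  integrable : ∀ (ω : Module.Dual ℚ 𝔥) (i : I), ∃ R : ℕ, ∀ r : ℕ, R ≤ r →
    W ⊓ weightSpace D κ (ω + r • D.root i) = ⊥ ∧ W ⊓ weightSpace D κ (ω - r • D.root i) = ⊥
  bounded : ∃ S : Finset (Module.Dual ℚ 𝔥), ∀ ω, W ⊓ weightSpace D κ ω ≠ ⊥ →
    ∃ lam ∈ S, D.Dominates lam ω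

/-- The category `Mod(U_q(ĝ))`: the `U_q(ĝ)`-modules which, as `U_q(𝔥)`-modules, are integrable and
in the category `𝒪`. -/
def InModUq (M : Type*) [AddCommGroup M] [Module ℂ M] [Module (Uq D) M]
    [IsScalarTower ℂ (Uq D) M] : Prop :=
  InModCartan D (fun h => Algebra.lsmul ℂ ℂ M (Uq.k D h)) ⊤

/-! ## The category `Mod(U'_q(ĝ))` -/

/-- An `(l,u)`-weight `(λ, Ψ)`; the entry `Ψ ε i m` is `Ψ^ε_{i, ε m}(u)`. -/
structure LUWeight where
  wt : Module.Dual ℚ 𝔥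
  Ψ : ℤˣ → I → ℕ → laurentRing
  Ψ_zero : ∀ ε i, Ψ ε i 0 =
    algebraMap ℂ laurentRing (D.qpow (((ε : ℤ) : ℚ) * (D.r i : ℚ) * wt (D.coroot i)))

section modules

variable (M : Type*) [AddCommGroup M] [Module (UqCu D) M] [Module Cu M]
  [IsScalarTower Cu (UqCu D) M]

/-- The action of an element of `U_q(ĝ)` on a `U'_q(ĝ)`-module, as a `ℂ(u)`-linear map. -/
def act (a : Uq D) : Module.End Cu M := Algebra.lsmul Cu Cu M (incl D a)

/-- The weight spaces of a `U'_q(ĝ)`-module; they are `ℂ(u)`-subspaces. -/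
def weightSpaceCu (ω : Module.Dual ℚ 𝔥) : Submodule Cu M :=
  weightSpace D (fun h => act D M (Uq.k D h)) ω

/-- The `(l,u)`-weight space `V_{(λ, Ψ)}`. -/
def luWeightSpace (Λ : LUWeight D) : Submodule Cu M where
  carrier := {v | v ∈ weightSpaceCu D M Λ.wt ∧ ∃ p : ℕ, ∀ (ε : ℤˣ) (i : I) (m : ℕ),
    ((act D M (Uq.phi D ε i ((ε : ℤ) * m)) -
      algebraMap Cu (Module.End Cu M) (Λ.Ψ ε i m : Cu)) ^ p) v = 0}
  zero_mem' := ⟨zero_mem _, 0, fun _ _ _ => map_zero _⟩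
  add_mem' := by
    rintro a b ⟨ha, p, hp⟩ ⟨hb, p', hp'⟩
    refine ⟨add_mem ha hb, p' + p, fun ε i m => ?_⟩
    rw [map_add]
    conv_lhs => enter [2]; rw [add_comm p' p]
    rw [pow_add, pow_add, Module.End.mul_apply, Module.End.mul_apply, hp, hp', map_zero, map_zero,
      add_zero]
  smul_mem' := by
    rintro c a ⟨ha, p, hp⟩
    exact ⟨Submodule.smul_mem _ c ha, p, fun ε i m => by rw [map_smul, hp, smul_zero]⟩

variable [Module ℂ M] [IsScalarTower ℂ Cu M] [IsScalarTower ℂ (UqCu D) M]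

/-- The action of `k_h` on a `U'_q(ĝ)`-module, as a `ℂ`-linear map. -/
def kActC (h : 𝔥) : Module.End ℂ M := Algebra.lsmul ℂ ℂ M (incl D (Uq.k D h))

variable {M} in
/-- The conditions relating a `U'_q(ĝ)`-module `M` and a `ℂ`-subspace `W` of `M`. -/
structure IsGenerating (W : Submodule ℂ M) : Prop where
  /-- The multiplication map `ℂ(u) ⊗ W → M` is an isomorphism. -/
  bijective : Function.Bijective (LinearMap.liftBaseChange Cu W.subtype)
  /-- `W` is stable under `U_q(𝔥)` and belongs to `Mod(U_q(𝔥))`. -/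
  cartan : InModCartan D (kActC D M) W
  /-- The image of `ℂ[u, u⁻¹] ⊗ W` in `M` is stable under `U_q(ĥ)`. -/
  lattice_stable : ∀ a ∈ UqCartan D, ∀ w ∈ Submodule.span laurentRing (W : Set M),
    incl D a • w ∈ Submodule.span laurentRing (W : Set M)
  /-- On each weight space of `W`, the operators `x^±_{i, r ± m}` (`m ≥ 0`) are a finite sum
  `∑ λ ^ m u ^ (k m) m ^ k' f_{k, k', λ}` with `k, k' ≥ 0` and `λ ≠ 0`. -/
  regular : ∀ (ω : Module.Dual ℚ 𝔥) (ε : ℤˣ) (i : I) (r : ℤ),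
    ∃ (S : Finset (ℕ × ℕ × ℂˣ))
      (f : ℕ × ℕ × ℂˣ → (↥(W ⊓ weightSpace D (kActC D M) ω) →ₗ[ℂ] M)),
      ∀ (m : ℕ) (w : ↥(W ⊓ weightSpace D (kActC D M) ω)),
        incl D (Uq.x D ε i (r + (ε : ℤ) * m)) • (w : M) =
          ∑ t ∈ S, (algebraMap ℂ Cu ((t.2.2 : ℂ) ^ m) * (RatFunc.X : Cu) ^ (t.1 * m) *
            (m : Cu) ^ t.2.1) • f t w

/-- The category `Mod(U'_q(ĝ))`. -/
structure InModUqCu : Prop where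
  exists_generating : ∃ W : Submodule ℂ M, IsGenerating D W
  lu_independent : iSupIndep (luWeightSpace D M)
  lu_iSup : ⨆ Λ, luWeightSpace D M Λ = ⊤

end modules

/-! ## `𝒜`-forms and their specialization -/

section forms

variable {M : Type*} [AddCommGroup M] [Module (UqCu D) M] [Module Cu M]
  [IsScalarTower Cu (UqCu D) M]

instance (L : Submodule 𝒜 M) : Module 𝒜 L := L.module

instance (L : Submodule 𝒜 M) : SMul 𝒜 L := (L.module).toSMul

variable (M) in
/-- `L` is an `𝒜`-form of the `U'_q(ĝ)`-module `M`. -/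
structure IsAForm (L : Submodule 𝒜 M) : Prop where
  stable : ∀ a ∈ UqA D, ∀ x ∈ L, a • x ∈ L
  span_eq : Submodule.span Cu (L : Set M) = ⊤
  fg : ∀ lam : Module.Dual ℚ 𝔥, (L ⊓ (weightSpaceCu D M lam).restrictScalars 𝒜).FG

variable {L : Submodule 𝒜 M} (hL : IsAForm D M L)

/-- The specialization `L / (u - 1) L` of an `𝒜`-form `L` at `u = 1`. -/
def Spec1 (_hL : IsAForm D M L) : Type _ := L ⧸ LinearMap.range (LinearMap.lsmul 𝒜 L uSubOne)

namespace Spec1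

instance : AddCommGroup (Spec1 D hL) :=
  inferInstanceAs (AddCommGroup (L ⧸ LinearMap.range (LinearMap.lsmul 𝒜 L uSubOne)))

instance : Module 𝒜 (Spec1 D hL) :=
  inferInstanceAs (Module 𝒜 (L ⧸ LinearMap.range (LinearMap.lsmul 𝒜 L uSubOne)))

/-- The class in `L / (u - 1) L` of an element of `L`. -/
def mk : L →ₗ[𝒜] Spec1 D hL := Submodule.mkQ _

/-- The action of an element of `U_q(ĝ)` on an `𝒜`-form. -/
def actForm (a : Uq D) : L →ₗ[𝒜] L where
  toFun x := ⟨incl D a • (x : M), hL.stable _ (incl_mem_UqA D a) _ x.2⟩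
  map_add' _ _ := Subtype.ext (smul_add _ _ _)
  map_smul' f x := Subtype.ext (smul_comm (incl D a) (f : Cu) (x : M))

/-- The action of `U_q(ĝ)` on the specialization: `a • [x] = [a • x]`. -/
def actSpec : Uq D →+* Module.End 𝒜 (Spec1 D hL) where
  toFun a := Submodule.mapQ _ _ (actForm D hL a) (by
    rintro _ ⟨x, rfl⟩
    exact ⟨actForm D hL a x, by simp⟩)
  map_one' := by
    refine Submodule.linearMap_qext _ (LinearMap.ext fun x => ?_)
    exact congrArg (mk D hL) (Subtype.ext (by simp [actForm]))
  map_mul' a b := by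
    refine Submodule.linearMap_qext _ (LinearMap.ext fun x => ?_)
    exact congrArg (mk D hL) (Subtype.ext (by simp [actForm, mul_smul]))
  map_zero' := by
    refine Submodule.linearMap_qext _ (LinearMap.ext fun x => ?_)
    exact congrArg (mk D hL) (Subtype.ext (by simp [actForm]))
  map_add' a b := by
    refine Submodule.linearMap_qext _ (LinearMap.ext fun x => ?_)
    exact congrArg (mk D hL) (Subtype.ext (by simp [actForm, add_smul]))

instance : Module (Uq D) (Spec1 D hL) := Module.compHom _ (actSpec D hL)

instance : Module ℂ (Spec1 D hL) := Module.compHom _ (algebraMap ℂ (Uq D))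

instance : IsScalarTower ℂ (Uq D) (Spec1 D hL) where
  smul_assoc c a m := by
    rw [Algebra.smul_def, mul_smul]; rfl

lemma smul_mk (a : Uq D) (x : L) : a • mk D hL x = mk D hL (actForm D hL a x) := rfl

end Spec1

end forms

section cyclic

variable {V : Type*} [AddCommGroup V] [Module (UqCu D) V]

/-- The submodule `U'_q(ĝ).v`. -/
abbrev cyc (v : V) : Submodule (UqCu D) V := Submodule.span (UqCu D) {v}

/-- `v` as an element of `U'_q(ĝ).v`. -/
def cycGen (v : V) : cyc D v := ⟨v, Submodule.mem_span_singleton_self v⟩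

variable [Module Cu V] [IsScalarTower Cu (UqCu D) V]

/-- The `𝒜`-submodule `U^u_q(ĝ).v` of `U'_q(ĝ).v`. -/
def cycForm (v : V) : Submodule 𝒜 (cyc D v) where
  carrier := {x | ∃ a ∈ UqA D, a • cycGen D v = x}
  zero_mem' := ⟨0, zero_mem _, zero_smul _ _⟩
  add_mem' := by
    rintro _ _ ⟨a, ha, rfl⟩ ⟨b, hb, rfl⟩
    exact ⟨a + b, add_mem ha hb, add_smul _ _ _⟩
  smul_mem' := by
    rintro f _ ⟨a, ha, rfl⟩
    exact ⟨(f : Cu) • a, smul_mem_UqA D f ha, smul_assoc (f : Cu) a (cycGen D v)⟩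

/-- `v` as an element of `U^u_q(ĝ).v`. -/
def cycFormGen (v : V) : cycForm D v := ⟨cycGen D v, 1, one_mem _, one_smul _ _⟩

end cyclic

end QAff

end

set_option linter.unusedSectionVars false

noncomputable section

namespace QAff

/-! ## The rings `ℂ[u, u⁻¹]` and `𝒜` -/

/-! Two finiteness statements carry the theorem.

The first is that `Mod(U'_q(ĝ))` is closed under submodules (`InModUqCu.submodule`). Weight and
`(l,u)`-weight decompositions are decompositions into simultaneous generalized eigenvectors, so by a
Bezout argument (`mem_of_sum_mem`) they pass to every stable subspace `N`. The `ℂ[u, u⁻¹]`-lattice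
spanned by `W` meets each weight space of `N` in a finitely generated torsion-free module over a
principal ideal domain, hence in a free one. The `ℂ`-span of bases of these intersections is a
generating subspace of `N`.

The second is that the orbit of a vector under `U_q(ĝ)` lies in a sum of finitely generated
`𝒜`-modules, one in each weight space (`IsGenerating.exists_family`). By `triangular` it suffices to
apply in turn products of `x⁺`, then of `φ`, then of `x⁻`. Weights are bounded above, so only words
of bounded length in the `x⁺` act nontrivially on a weight vector; a given weight is reached by
finitely many index sequences of `x⁻`. The remaining infinity is that of the modes `r`. The sequence
`r ↦ x_{i,r} y` is exponential polynomial on every half line, with bases `λ u ^ k` that are units of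
`𝒜`. It therefore satisfies a linear recurrence whose constant coefficient is a unit, which can be
solved backwards, and all its values lie in the span of the coefficient vectors of a single
half-line expansion (`exists_fg_of_isExpPoly`). The `φ` are controlled by the stable lattice. Since
`𝒜` is noetherian, `U^u_q(ĝ).v` is an `𝒜`-form (`isAForm_of_generator`).

The eigenvalues of the `k_h` do not involve `u`, so the weight decomposition survives at `u = 1`,
with finite-dimensional pieces. The quotient is nonzero by Nakayama's lemma, applied in each weight
space (`Spec1.nontrivial`). -/

lemma isPrincipalIdealRing_of_fractions {R A : Type*} [CommRing R] [IsPrincipalIdealRing R]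
    [CommRing A] (φ : R →+* A)
    (h : ∀ x : A, ∃ f g : R, IsUnit (φ g) ∧ x * φ g = φ f) : IsPrincipalIdealRing A := by
  refine ⟨fun J => ?_⟩
  -- As in a localization, an ideal is generated by the image of its preimage, because denominators
  -- are units.
  obtain ⟨p, hp⟩ := (IsPrincipalIdealRing.principal (J.comap φ)).principal
  refine ⟨φ p, le_antisymm (fun x hx => ?_) ?_⟩
  · obtain ⟨f, g, hg, hfg⟩ := h x
    have hf : f ∈ J.comap φ := by
      rw [Ideal.mem_comap, ← hfg]
      exact J.mul_mem_right _ hx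
    rw [hp] at hf
    obtain ⟨a, rfl⟩ := Submodule.mem_span_singleton.1 hf
    obtain ⟨b, hb⟩ := hg.exists_right_inv
    refine Submodule.mem_span_singleton.2 ⟨b * φ a, ?_⟩
    have : x = x * φ g * b := by rw [mul_assoc, hb, mul_one]
    rw [this, hfg, smul_eq_mul, smul_eq_mul, map_mul]
    ring
  · rw [Submodule.span_singleton_le_iff_mem]
    have : p ∈ J.comap φ := by rw [hp]; exact Submodule.mem_span_singleton_self p
    exact this

lemma algebraMap_ne_zero_of_eval {p : Polynomial ℂ} {z : ℂ} (hp : p.eval z ≠ 0) :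
    algebraMap (Polynomial ℂ) Cu p ≠ 0 := by
  intro h
  have : p = 0 := (map_eq_zero_iff _ (RatFunc.algebraMap_injective ℂ)).1 h
  simp [this] at hp

/-- The inclusion of `ℂ[u]` in `𝒜`. -/
def polyTo𝒜 : Polynomial ℂ →+* 𝒜 :=
  (algebraMap (Polynomial ℂ) Cu).codRestrict 𝒜.toSubring
    fun f => ⟨f, 1, by simp, by simp⟩

lemma coe_polyTo𝒜 (f : Polynomial ℂ) : (polyTo𝒜 f : Cu) = algebraMap _ Cu f := rfl

lemma isUnit_polyTo𝒜 {g : Polynomial ℂ} (hg : g.eval 1 ≠ 0) : IsUnit (polyTo𝒜 g) := by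
  refine IsUnit.of_mul_eq_one (⟨(algebraMap _ Cu g)⁻¹, 1, g, hg, by simp⟩ : 𝒜) (Subtype.ext ?_)
  exact mul_inv_cancel₀ (algebraMap_ne_zero_of_eval hg)

lemma 𝒜_exists_fraction (x : 𝒜) :
    ∃ f g : Polynomial ℂ, IsUnit (polyTo𝒜 g) ∧ x * polyTo𝒜 g = polyTo𝒜 f := by
  obtain ⟨x, f, g, hg, rfl⟩ := x
  refine ⟨f, g, isUnit_polyTo𝒜 hg, Subtype.ext ?_⟩
  exact div_mul_cancel₀ _ (algebraMap_ne_zero_of_eval hg)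

instance : IsPrincipalIdealRing 𝒜 :=
  isPrincipalIdealRing_of_fractions polyTo𝒜 𝒜_exists_fraction

lemma uSubOne_ne_zero : (uSubOne : Cu) ≠ 0 := by
  have : (uSubOne : Cu) = algebraMap (Polynomial ℂ) Cu (Polynomial.X - 1) := by simp [uSubOne]
  rw [this]
  exact algebraMap_ne_zero_of_eval (z := 0) (by simp)

/-- Elements of `𝒜` have a value at `u = 1`. -/
lemma 𝒜_exists_eval (x : 𝒜) : ∃ (c : ℂ) (y : 𝒜), x = algebraMap ℂ 𝒜 c + uSubOne * y := by
  obtain ⟨x, f, g, hg, rfl⟩ := x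
  -- The constant is the value of `f / g` at `1`; subtracting it leaves a numerator divisible by `u
  -- - 1`.
  have hroot : (f - Polynomial.C (f.eval 1 / g.eval 1) * g).eval 1 = 0 := by
    simp [div_mul_cancel₀ _ hg]
  obtain ⟨k, hk⟩ := Polynomial.dvd_iff_isRoot.2 hroot
  refine ⟨f.eval 1 / g.eval 1, ⟨_, k, g, hg, rfl⟩, Subtype.ext ?_⟩
  have hg' := algebraMap_ne_zero_of_eval hg
  have hk' := congrArg (algebraMap (Polynomial ℂ) Cu) hk
  rw [map_sub, map_mul, map_mul, map_sub] at hk'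
  have hX : (uSubOne : Cu) = algebraMap (Polynomial ℂ) Cu (Polynomial.X)
      - algebraMap (Polynomial ℂ) Cu (Polynomial.C 1) := by simp [uSubOne]
  have hc : ((algebraMap ℂ 𝒜 (f.eval 1 / g.eval 1) : 𝒜) : Cu)
      = algebraMap (Polynomial ℂ) Cu (Polynomial.C (f.eval 1 / g.eval 1)) := rfl
  change _ = ((algebraMap ℂ 𝒜 (f.eval 1 / g.eval 1) : 𝒜) : Cu) + (uSubOne : Cu) * _
  rw [hX, hc, mul_div_assoc', ← hk']
  field_simp
  ring

lemma isUnit_one_add_uSubOne_mul (y : 𝒜) : IsUnit (1 + uSubOne * y) := by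
  obtain ⟨y, f, g, hg, rfl⟩ := y
  have h : IsUnit (polyTo𝒜 (g + (Polynomial.X - 1) * f)) := isUnit_polyTo𝒜 (by simpa using hg)
  have hg' := algebraMap_ne_zero_of_eval hg
  refine isUnit_of_mul_isUnit_left (y := polyTo𝒜 g) ?_
  convert h using 1
  refine Subtype.ext ?_
  change (1 + (RatFunc.X - 1) * (_ / _)) * algebraMap _ Cu g = algebraMap _ Cu _
  rw [map_add, map_mul, map_sub, map_one, RatFunc.algebraMap_X]
  field_simp

/-- This is the hypothesis of Nakayama's lemma used for the nonvanishing of the specialization. -/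
lemma span_uSubOne_le_jacobson : Ideal.span {uSubOne} ≤ Ideal.jacobson (⊥ : Ideal 𝒜) := by
  rw [Ideal.span_singleton_le_iff_mem, Ideal.mem_jacobson_bot]
  intro y
  rw [add_comm]
  exact isUnit_one_add_uSubOne_mul y

/-- The element `u` of `𝒜`, as a unit. -/
lemma exists_unit_X : ∃ z : 𝒜ˣ, ((z : 𝒜) : Cu) = RatFunc.X := by
  obtain ⟨z, hz⟩ := isUnit_polyTo𝒜 (g := Polynomial.X) (by simp)
  exact ⟨z, by rw [hz, coe_polyTo𝒜, RatFunc.algebraMap_X]⟩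

/-- The inclusion of `ℂ[u]` in `ℂ[u, u⁻¹]`. -/
def polyToLaurent : Polynomial ℂ →+* laurentRing :=
  (Polynomial.aeval (⟨RatFunc.X, Algebra.subset_adjoin (by simp)⟩ : laurentRing)).toRingHom

lemma coe_polyToLaurent (f : Polynomial ℂ) : (polyToLaurent f : Cu) = algebraMap _ Cu f := by
  have h : laurentRing.val.comp (Polynomial.aeval
      (⟨RatFunc.X, Algebra.subset_adjoin (by simp)⟩ : laurentRing)) =
      IsScalarTower.toAlgHom ℂ (Polynomial ℂ) Cu := by
    refine Polynomial.algHom_ext ?_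
    simp
  exact DFunLike.congr_fun h f

lemma isUnit_polyToLaurent_X_pow (n : ℕ) : IsUnit (polyToLaurent (Polynomial.X ^ n)) := by
  rw [map_pow]
  refine IsUnit.pow n ?_
  refine IsUnit.of_mul_eq_one
    (⟨RatFunc.X⁻¹, Algebra.subset_adjoin (by simp)⟩ : laurentRing) (Subtype.ext ?_)
  change (polyToLaurent Polynomial.X : Cu) * _ = 1
  rw [coe_polyToLaurent, RatFunc.algebraMap_X]
  exact mul_inv_cancel₀ RatFunc.X_ne_zero

lemma laurentRing_exists_fraction (x : Cu) (hx : x ∈ laurentRing) :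
    ∃ (f : Polynomial ℂ) (n : ℕ), x * RatFunc.X ^ n = algebraMap _ Cu f := by
  have hX : (RatFunc.X : Cu) ≠ 0 := RatFunc.X_ne_zero
  induction hx using Algebra.adjoin_induction with
  | mem x hx =>
    rcases hx with rfl | rfl
    · exact ⟨Polynomial.X, 0, by simp⟩
    · exact ⟨1, 1, by simp [hX]⟩
  | algebraMap c => exact ⟨Polynomial.C c, 0, by rw [pow_zero, mul_one]; rfl⟩
  | add x y _ _ hx hy =>
    obtain ⟨f, n, hf⟩ := hx
    obtain ⟨g, m, hg⟩ := hy
    refine ⟨f * Polynomial.X ^ m + g * Polynomial.X ^ n, n + m, ?_⟩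
    simp only [map_add, map_mul, map_pow, RatFunc.algebraMap_X, ← hf, ← hg]
    ring
  | mul x y _ _ hx hy =>
    obtain ⟨f, n, hf⟩ := hx
    obtain ⟨g, m, hg⟩ := hy
    refine ⟨f * g, n + m, ?_⟩
    simp only [map_mul, ← hf, ← hg]
    ring

instance : IsPrincipalIdealRing laurentRing := by
  refine isPrincipalIdealRing_of_fractions polyToLaurent fun x => ?_
  obtain ⟨f, n, h⟩ := laurentRing_exists_fraction x x.2
  refine ⟨f, _, isUnit_polyToLaurent_X_pow n, Subtype.ext ?_⟩
  change (x : Cu) * (polyToLaurent _ : Cu) = (polyToLaurent f : Cu)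
  rw [coe_polyToLaurent, coe_polyToLaurent, ← h, map_pow, RatFunc.algebraMap_X]

lemma laurentRing_le_𝒜 : laurentRing ≤ 𝒜 := by
  refine Algebra.adjoin_le ?_
  rintro x (rfl | rfl)
  · exact ⟨Polynomial.X, 1, by simp, by simp⟩
  · exact ⟨1, Polynomial.X, by simp, by simp⟩

/-- Together with principality, this turns a lattice over `ℂ[u, u⁻¹]` into a `ℂ(u)`-basis of the
subspace it spans. -/
instance : IsFractionRing laurentRing Cu := by
  refine IsFractionRing.of_field laurentRing Cu fun z => ?_
  obtain ⟨f, g, -, rfl⟩ := RatFunc.induction_on z (P := fun z => ∃ f g : Polynomial ℂ, g ≠ 0 ∧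
      z = algebraMap _ Cu f / algebraMap _ Cu g) (fun p q hq => ⟨p, q, hq, rfl⟩)
  refine ⟨polyToLaurent f, polyToLaurent g, ?_⟩
  change _ = (polyToLaurent f : Cu) / (polyToLaurent g : Cu)
  rw [coe_polyToLaurent, coe_polyToLaurent]

/-! ## Separation of generalized eigenvectors -/

section separation

variable {F M : Type*} [Field F] [AddCommGroup M] [Module F M]

lemma pow_apply_eq_zero_of_le {T : Module.End F M} {p p' : ℕ} (h : p ≤ p') {x : M}
    (hx : (T ^ p) x = 0) : (T ^ p') x = 0 := by
  obtain ⟨k, rfl⟩ := Nat.exists_eq_add_of_le' h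
  rw [pow_add, Module.End.mul_apply, hx, map_zero]

lemma aeval_mem (T : Module.End F M) (N : Submodule F M) (hN : ∀ x ∈ N, T x ∈ N)
    (P : Polynomial F) {x : M} (hx : x ∈ N) : Polynomial.aeval T P x ∈ N := by
  induction P using Polynomial.induction_on' with
  | add p q hp hq => rw [map_add, LinearMap.add_apply]; exact add_mem hp hq
  | monomial n a =>
    rw [Polynomial.aeval_monomial, Module.End.mul_apply, Module.algebraMap_end_apply]
    refine N.smul_mem a ?_
    induction n with
    | zero => simpa using hx
    | succ n ih => rw [pow_succ', Module.End.mul_apply]; exact hN _ ih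

/-- By coprimality of `(X - b) ^ p` with the product of the other factors, Bezout gives a polynomial
in `T` that fixes `w b` and kills the other summands. A stable subspace is preserved by this
projector. -/
lemma generalized_eigenvector_mem (T : Module.End F M) (N : Submodule F M)
    (hN : ∀ x ∈ N, T x ∈ N) (B : Finset F) (w : F → M) (p : ℕ)
    (hw : ∀ b ∈ B, ((T - algebraMap F (Module.End F M) b) ^ p) (w b) = 0)
    (hsum : ∑ b ∈ B, w b ∈ N) : ∀ b ∈ B, w b ∈ N := by
  classical
  intro b hb
  have haev : ∀ b : F, Polynomial.aeval T ((Polynomial.X - Polynomial.C b) ^ p) =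
      (T - algebraMap F (Module.End F M) b) ^ p := by
    intro b
    simp
  have hcop : IsCoprime ((Polynomial.X - Polynomial.C b) ^ p)
      (∏ b' ∈ B.erase b, (Polynomial.X - Polynomial.C b') ^ p) := by
    refine IsCoprime.prod_right fun b' hb' => IsCoprime.pow ?_
    exact Polynomial.isCoprime_X_sub_C_of_isUnit_sub
      (sub_ne_zero.2 (Finset.ne_of_mem_erase hb').symm).isUnit
  obtain ⟨U, U', hU⟩ := hcop
  have h1 : w b = Polynomial.aeval T (U' * ∏ b' ∈ B.erase b,
      (Polynomial.X - Polynomial.C b') ^ p) (w b) := by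
    have := congrArg (fun P => Polynomial.aeval T P (w b)) hU
    simp only [map_add, map_mul, map_one, LinearMap.add_apply, Module.End.mul_apply,
      Module.End.one_apply] at this
    rw [haev, hw b hb, map_zero, zero_add] at this
    rw [map_mul, Module.End.mul_apply, this]
  have h2 : ∀ b' ∈ B.erase b, Polynomial.aeval T (U' * ∏ b' ∈ B.erase b,
      (Polynomial.X - Polynomial.C b') ^ p) (w b') = 0 := by
    intro b' hb'
    rw [← Finset.mul_prod_erase _ _ hb', mul_left_comm, mul_comm, map_mul, Module.End.mul_apply,
      haev, hw b' (Finset.mem_of_mem_erase hb'), map_zero]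
  have h3 := aeval_mem T N hN (U' * ∏ b' ∈ B.erase b, (Polynomial.X - Polynomial.C b') ^ p) hsum
  rw [← Finset.add_sum_erase _ _ hb, map_add, map_sum, Finset.sum_eq_zero h2, add_zero,
    ← h1] at h3
  exact h3

/-- If a stable subspace contains a sum of simultaneous generalized eigenvectors with distinct
systems of eigenvalues, then it contains the summands. -/
lemma mem_of_sum_mem {ι κ : Type*} (T : κ → Module.End F M) (a : ι → κ → F)
    (sep : ∀ i j, i ≠ j → ∃ k, a i k ≠ a j k) (N : Submodule F M)
    (hN : ∀ k, ∀ x ∈ N, T k x ∈ N) (S : Finset ι) (v : ι → M)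
    (hv : ∀ i ∈ S, ∃ p : ℕ, ∀ k, ((T k - algebraMap F (Module.End F M) (a i k)) ^ p) (v i) = 0)
    (hsum : ∑ i ∈ S, v i ∈ N) : ∀ i ∈ S, v i ∈ N := by
  classical
  induction S using Finset.strongInduction with
  | H S ih =>
    intro i₀ hi₀
    by_cases hS : ∀ i ∈ S, i = i₀
    · have : S = {i₀} := Finset.eq_singleton_iff_unique_mem.2 ⟨hi₀, hS⟩
      rwa [this, Finset.sum_singleton] at hsum
    · push Not at hS
      obtain ⟨j, hj, hij⟩ := hS
      obtain ⟨k, hk⟩ := sep j i₀ hij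
      have hv' : ∀ i, ∃ p : ℕ, i ∈ S →
          ((T k - algebraMap F (Module.End F M) (a i k)) ^ p) (v i) = 0 := by
        intro i
        by_cases hi : i ∈ S
        · obtain ⟨p, hp⟩ := hv i hi
          exact ⟨p, fun _ => hp k⟩
        · exact ⟨0, fun h => absurd h hi⟩
      choose p hp using hv'
      -- Grouping the summands by their eigenvalue for `T k` leaves the partial sum over the group
      -- of `i₀`, which omits `j` and is thus shorter.
      have key := generalized_eigenvector_mem (T k) N (hN k) (S.image fun i => a i k)
        (fun b => ∑ i ∈ S with a i k = b, v i) (S.sup p) (by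
          intro b _
          rw [map_sum]
          refine Finset.sum_eq_zero fun i hi => ?_
          rw [Finset.mem_filter] at hi
          rw [← hi.2]
          exact pow_apply_eq_zero_of_le (Finset.le_sup hi.1) (hp i hi.1)) ((Finset.sum_fiberwise_of_maps_to (s := S) (t := S.image fun i => a i k)
          (g := fun i => a i k) (fun i hi => Finset.mem_image_of_mem _ hi) v).symm ▸ hsum)
        (a i₀ k) (Finset.mem_image_of_mem _ hi₀)
      refine ih (S.filter fun i => a i k = a i₀ k) ?_ ?_ key i₀ (by simp [hi₀])
      · exact Finset.filter_ssubset.2 ⟨j, hj, hk⟩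
      · exact fun i hi => hv i (Finset.mem_filter.1 hi).1

lemma eq_zero_of_sum_eq_zero {ι κ : Type*} (T : κ → Module.End F M) (a : ι → κ → F)
    (sep : ∀ i j, i ≠ j → ∃ k, a i k ≠ a j k) (S : Finset ι) (v : ι → M)
    (hv : ∀ i ∈ S, ∃ p : ℕ, ∀ k, ((T k - algebraMap F (Module.End F M) (a i k)) ^ p) (v i) = 0)
    (hsum : ∑ i ∈ S, v i = 0) : ∀ i ∈ S, v i = 0 := by
  have := mem_of_sum_mem T a sep ⊥ (by simp) S v hv (by simpa using hsum)
  simpa using this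

end separation

/-! ### Separation of weights by the operators `k_h`. -/

section

variable {I : Type*} [Fintype I] [DecidableEq I] {𝔥 : Type*} [AddCommGroup 𝔥] [Module ℚ 𝔥]
  (D : Datum I 𝔥)

lemma Datum.qpow_ne_zero (s : ℚ) : D.qpow s ≠ 0 := Complex.exp_ne_zero _

lemma Datum.qpow_one_sub_ne_zero : D.qpow 1 - D.qpow (-1) ≠ 0 := by
  intro h
  refine D.not_root_of_unity 2 two_pos ?_
  have h' : Complex.exp D.logq = (Complex.exp D.logq)⁻¹ := by
    have := sub_eq_zero.1 h
    simpa [Datum.qpow, Complex.exp_neg] using this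
  rw [sq]
  nth_rw 2 [h']
  exact mul_inv_cancel₀ (Complex.exp_ne_zero _)

/-- Since `𝔥` is a rational vector space, a vector on which the weights differ can be rescaled so
that they differ by `1`. Equality of the characters would then force `q = 1`. -/
lemma Datum.qpow_separates {ω ω' : Module.Dual ℚ 𝔥} (h : ω ≠ ω') :
    ∃ x, D.qpow (ω x) ≠ D.qpow (ω' x) := by
  by_contra! hcon
  refine h (LinearMap.ext fun x => ?_)
  by_contra hx
  set s : ℚ := ω x - ω' x with hs
  have hs0 : s ≠ 0 := sub_ne_zero.2 hx
  have hone : ∀ c : ℚ, Complex.exp (((c * s : ℚ) : ℂ) * D.logq) = 1 := by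
    intro c
    have := hcon (c • x)
    simp only [map_smul, smul_eq_mul, Datum.qpow] at this
    rw [hs, mul_sub, Rat.cast_sub, sub_mul, Complex.exp_sub, this,
      div_self (Complex.exp_ne_zero _)]
  refine D.not_root_of_unity 1 one_pos ?_
  have := hone s⁻¹
  rw [inv_mul_cancel₀ hs0] at this
  simpa using this

section weights

variable {F : Type*} [Field F] [Algebra ℂ F] {M : Type*} [AddCommGroup M] [Module F M]

variable {D} in
lemma weightSpace_pow {κ : 𝔥 → Module.End F M} {ω : Module.Dual ℚ 𝔥} {v : M}
    (hv : v ∈ weightSpace D κ ω) :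
    ∃ p : ℕ, ∀ k, ((κ k - algebraMap F (Module.End F M) (algebraMap ℂ F (D.qpow (ω k)))) ^ p) v
      = 0 := by
  refine ⟨1, fun k => ?_⟩
  rw [pow_one, LinearMap.sub_apply, Module.algebraMap_end_apply, hv k, sub_self]

lemma weight_separates (F : Type*) [Field F] [Algebra ℂ F] (ω ω' : Module.Dual ℚ 𝔥)
    (h : ω ≠ ω') : ∃ x, algebraMap ℂ F (D.qpow (ω x)) ≠ algebraMap ℂ F (D.qpow (ω' x)) := by
  obtain ⟨x, hx⟩ := D.qpow_separates h
  exact ⟨x, fun h => hx ((algebraMap ℂ F).injective h)⟩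

lemma weight_mem_of_sum_mem (κ : 𝔥 → Module.End F M) (N : Submodule F M)
    (hN : ∀ k, ∀ x ∈ N, κ k x ∈ N) (S : Finset (Module.Dual ℚ 𝔥)) (v : Module.Dual ℚ 𝔥 → M)
    (hv : ∀ ω ∈ S, v ω ∈ weightSpace D κ ω) (hsum : ∑ ω ∈ S, v ω ∈ N) : ∀ ω ∈ S, v ω ∈ N :=
  mem_of_sum_mem κ _ (weight_separates D F) N hN S v
    (fun ω hω => weightSpace_pow (hv ω hω)) hsum

lemma weightSpace_iSupIndep (κ : 𝔥 → Module.End F M) : iSupIndep (weightSpace D κ) := by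
  rw [iSupIndep_iff_finsetSum_eq_zero_imp_eq_zero]
  intro S v hv h0
  simpa using weight_mem_of_sum_mem D κ ⊥ (by simp) S v hv (by simpa using h0)

/-- A sum of weight vectors which is itself a weight vector is equal to the component of
that weight. -/
lemma eq_component_of_mem_weightSpace (κ : 𝔥 → Module.End F M) (S : Finset (Module.Dual ℚ 𝔥))
    (v : Module.Dual ℚ 𝔥 → M) (hv : ∀ ω ∈ S, v ω ∈ weightSpace D κ ω) {ω : Module.Dual ℚ 𝔥}
    {x : M} (hx : x ∈ weightSpace D κ ω) (hsum : ∑ ω ∈ S, v ω = x) :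
    (ω ∈ S → x = v ω) ∧ (ω ∉ S → x = 0) := by
  classical
  -- Independence is applied to the family `v` extended by zero to `ω`, minus `x` placed in weight
  -- `ω`, whose sum is zero.
  have h := (iSupIndep_iff_finsetSum_eq_zero_imp_eq_zero _).1 (weightSpace_iSupIndep D κ)
    (insert ω S) (fun ω' => (if ω' ∈ S then v ω' else 0) - if ω' = ω then x else 0) (by
      intro ω' _
      refine sub_mem ?_ ?_
      · split_ifs with h
        exacts [hv _ h, zero_mem _]
      · split_ifs with h
        exacts [h ▸ hx, zero_mem _]) (by
      rw [Finset.sum_sub_distrib, Finset.sum_ite_eq' (insert ω S) ω,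
        if_pos (Finset.mem_insert_self _ _), Finset.sum_ite_mem,
        Finset.inter_eq_right.2 (Finset.subset_insert _ _), hsum, sub_self]) ω (by simp)
  simp only [if_true] at h
  refine ⟨fun hω => ?_, fun hω => ?_⟩
  · rw [if_pos hω] at h
    exact (sub_eq_zero.1 h).symm
  · rw [if_neg hω, zero_sub] at h
    exact neg_eq_zero.1 h

end weights

end

/-! ## The triangular decomposition -/

lemma coeff_pow_mem {A : Type*} [Ring A] [Algebra ℂ A] (S : Subalgebra ℂ A) (H : PowerSeries A)
    (m : ℕ) (hH : ∀ j < m, PowerSeries.coeff j H ∈ S) (n : ℕ) :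
    ∀ j < m, PowerSeries.coeff j (H ^ n) ∈ S := by
  induction n with
  | zero =>
    intro j _
    rw [pow_zero, PowerSeries.coeff_one]
    split_ifs
    exacts [one_mem _, zero_mem _]
  | succ n ih =>
    intro j hj
    rw [pow_succ, PowerSeries.coeff_mul]
    refine sum_mem fun p hp => ?_
    have := Finset.HasAntidiagonal.mem_antidiagonal.1 hp
    exact mul_mem (ih _ (by lia)) (hH _ (by lia))

/-- As the constant term vanishes, the degree `m` coefficient of a power of exponent at least two
involves only coefficients of degree less than `m`. This is what allows the exponential defining `φ`
to be inverted degree by degree. -/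
lemma coeff_pow_add_two_mem {A : Type*} [Ring A] [Algebra ℂ A] (S : Subalgebra ℂ A)
    (H : PowerSeries A) (h0 : PowerSeries.coeff 0 H = 0) (m : ℕ)
    (hH : ∀ j < m, PowerSeries.coeff j H ∈ S) (n : ℕ) :
    PowerSeries.coeff m (H ^ (n + 2)) ∈ S := by
  rw [pow_succ, PowerSeries.coeff_mul]
  refine sum_mem fun p hp => ?_
  have hp := Finset.HasAntidiagonal.mem_antidiagonal.1 hp
  rcases Nat.eq_zero_or_pos p.2 with h2 | h2
  · rw [h2, h0, mul_zero]
    exact zero_mem _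
  rcases Nat.eq_zero_or_pos p.1 with h1 | h1
  · have : PowerSeries.coeff 0 (H ^ (n + 1)) = 0 := by
      rw [pow_succ, PowerSeries.coeff_mul]
      simp [h0]
    rw [h1, this, zero_mul]
    exact zero_mem _
  exact mul_mem (coeff_pow_mem S H m hH _ _ (by lia)) (hH _ (by lia))

section

variable {I : Type*} [Fintype I] [DecidableEq I] {𝔥 : Type*} [AddCommGroup 𝔥] [Module ℚ 𝔥]
  (D : Datum I 𝔥)

/-! ### Relations read in the quantum affinization. -/

namespace Uq

lemma proj_surjective : Function.Surjective (proj D) := RingQuot.mkAlgHom_surjective ℂ (Rel D)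

variable {D} in
lemma proj_eq {a b : Free I 𝔥} (h : Rel D a b) : proj D a = proj D b :=
  RingQuot.mkAlgHom_rel ℂ h

lemma k_add (h h' : 𝔥) : k D h * k D h' = k D (h + h') := by
  simpa [k] using proj_eq (Rel.k_add (D := D) h h')

lemma k_zero : k D 0 = 1 := by
  simpa [k] using proj_eq (Rel.k_zero (D := D))

/-- The element `φ^ε_{i, ε m}`. -/
def phiN (ε : ℤˣ) (i : I) (m : ℕ) : Uq D := phi D ε i ((ε : ℤ) * m)

lemma units_mul_self (ε : ℤˣ) : (ε : ℤ) * ε = 1 := by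
  rcases Int.units_eq_one_or ε with rfl | rfl <;> simp

lemma phiN_eq (ε : ℤˣ) (i : I) (m : ℕ) : phiN D ε i m =
    k D (((ε : ℤ) * (D.r i : ℤ)) • D.coroot i) *
      proj D (∑ n ∈ Finset.range (m + 1),
        ((n.factorial : ℂ)⁻¹) • PowerSeries.coeff m (hSeries D fh ε i ^ n)) := by
  have h1 : (ε : ℤ) * ((ε : ℤ) * m) = m := by rw [← mul_assoc, units_mul_self, one_mul]
  have h2 : ((ε : ℤ) * m).natAbs = m := by
    rw [Int.natAbs_mul, Int.units_natAbs, one_mul, Int.natAbs_natCast]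
  rw [phiN, phi, fphi, phiInt, h1, if_pos (Int.natCast_nonneg m), h2, phiNat, map_mul]
  rfl

lemma k_phiN (h : 𝔥) (ε : ℤˣ) (i : I) (m : ℕ) :
    k D h * phiN D ε i m = phiN D ε i m * k D h := by
  simpa [k, phiN, phi] using proj_eq (Rel.k_phi (D := D) h ε i ((ε : ℤ) * m))

lemma k_x (h : 𝔥) (ε : ℤˣ) (j : I) (r : ℤ) :
    k D h * x D ε j r = D.qpow (((ε : ℤ) : ℚ) * D.root j h) • (x D ε j r * k D h) := by
  simpa [k, x] using proj_eq (Rel.k_x (D := D) h ε j r)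

/-- Both expansions of the structure function are treated at once. Beyond the triangular shape, only
the invertibility of the leading coefficient matters: it permits moving `φ` across `x` in either
direction. -/
lemma exists_phiN_x (ε' ε : ℤˣ) (i j : I) : ∃ g : ℕ → ℂ, g 0 ≠ 0 ∧ ∀ (m : ℕ) (r : ℤ),
    phiN D ε' i m * x D ε j r =
      ∑ p ∈ Finset.range (m + 1), g p • (x D ε j (r + ε' * p) * phiN D ε' i (m - p)) := by
  set c := D.qpow ((ε : ℤ) * D.B i j : ℤ) with hc
  have hc0 : c ≠ 0 := D.qpow_ne_zero _
  rcases Int.units_eq_one_or ε' with rfl | rfl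
  · refine ⟨fun p => PowerSeries.coeff p (gPlus c), ?_, fun m r => ?_⟩
    · simpa [gPlus] using hc0
    · have h := proj_eq (Rel.phi_plus_x (D := D) ε i j m r)
      simp only [map_mul, map_sum, map_smul] at h
      simp only [phiN, Units.val_one, one_mul, phi, x]
      rw [h]
      refine Finset.sum_congr rfl fun p hp => ?_
      rw [Nat.cast_sub (Nat.lt_succ_iff.1 (Finset.mem_range.1 hp))]
  · refine ⟨fun p => PowerSeries.coeff p (gMinus c), ?_, fun m r => ?_⟩
    · simpa [gMinus] using hc0
    · have h := proj_eq (Rel.phi_minus_x (D := D) ε i j m r)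
      simp only [map_mul, map_sum, map_smul] at h
      simp only [phiN, Units.val_neg, Units.val_one, neg_one_mul, phi, x]
      rw [h]
      refine Finset.sum_congr rfl fun p hp => ?_
      rw [Nat.cast_sub (Nat.lt_succ_iff.1 (Finset.mem_range.1 hp)), sub_eq_add_neg]

end Uq

/-- The subalgebra generated by the `k_h` and the `φ^ε_{i, ε m}`. -/
def phiAlg : Subalgebra ℂ (Uq D) :=
  Algebra.adjoin ℂ (Set.range (Uq.k D) ∪
    Set.range fun p : ℤˣ × I × ℕ => Uq.phiN D p.1 p.2.1 p.2.2)

variable {D} in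
lemma k_mem_phiAlg (h : 𝔥) : Uq.k D h ∈ phiAlg D :=
  Algebra.subset_adjoin (Or.inl ⟨h, rfl⟩)

variable {D} in
lemma phiN_mem_phiAlg (ε : ℤˣ) (i : I) (m : ℕ) : Uq.phiN D ε i m ∈ phiAlg D :=
  Algebra.subset_adjoin (Or.inr ⟨(ε, i, m), rfl⟩)

lemma coeff_hSeries_zero {A : Type*} [Ring A] [Algebra ℂ A] (h : I → {m : ℤ // m ≠ 0} → A)
    (ε : ℤˣ) (i : I) : PowerSeries.coeff 0 (hSeries D h ε i) = 0 := by
  simp [hSeries]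

/-- The coefficient of degree `m > 0` of the exponential is the sought coefficient plus terms in
lower ones, so induction recovers it from `φ` after removal of the invertible factor `k`. -/
lemma proj_coeff_hSeries_mem (ε : ℤˣ) (i : I) (m : ℕ) :
    PowerSeries.coeff m (hSeries D fh ε i) ∈ (phiAlg D).comap (Uq.proj D) := by
  induction m using Nat.strong_induction_on with
  | _ m ih =>
    rcases Nat.eq_zero_or_pos m with rfl | hm
    · rw [coeff_hSeries_zero]
      exact zero_mem _
    obtain ⟨n, rfl⟩ := Nat.exists_eq_add_of_le' hm
    set S := (phiAlg D).comap (Uq.proj D) with hS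
    have hsum : (∑ l ∈ Finset.range (n + 1 + 1), ((l.factorial : ℂ)⁻¹) •
        PowerSeries.coeff (n + 1) (hSeries D fh ε i ^ l)) ∈ S := by
      rw [hS, Subalgebra.mem_comap]
      have h := phiN_mem_phiAlg (D := D) ε i (n + 1)
      rw [Uq.phiN_eq] at h
      have h' := mul_mem (k_mem_phiAlg (D := D) (-(((ε : ℤ) * (D.r i : ℤ)) • D.coroot i))) h
      rwa [← mul_assoc, Uq.k_add, neg_add_cancel, Uq.k_zero, one_mul] at h'
    rw [Finset.sum_range_succ', Finset.sum_range_succ'] at hsum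
    have h0 : PowerSeries.coeff (n + 1) (hSeries D (fh (𝔥 := 𝔥)) ε i ^ 0) = 0 := by
      rw [pow_zero, PowerSeries.coeff_one, if_neg (Nat.succ_ne_zero n)]
    rw [h0, smul_zero, add_zero, zero_add, pow_one, Nat.factorial_one, Nat.cast_one, inv_one,
      one_smul] at hsum
    have hrest : (∑ l ∈ Finset.range n, (((l + 1 + 1).factorial : ℂ)⁻¹) •
        PowerSeries.coeff (n + 1) (hSeries D fh ε i ^ (l + 1 + 1))) ∈ S :=
      sum_mem fun l _ => Subalgebra.smul_mem _
        (coeff_pow_add_two_mem S _ (coeff_hSeries_zero D _ ε i) (n + 1) ih l) _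
    simpa using sub_mem hsum hrest

lemma h_mem_phiAlg (i : I) (m : {m : ℤ // m ≠ 0}) : Uq.h D i m ∈ phiAlg D := by
  obtain ⟨m, hm⟩ := m
  obtain ⟨ε, p, hp, rfl⟩ : ∃ (ε : ℤˣ) (p : ℕ), p ≠ 0 ∧ (ε : ℤ) * p = m := by
    rcases le_total 0 m with h | h
    · exact ⟨1, m.natAbs, by lia, by rw [Units.val_one]; lia⟩
    · exact ⟨-1, m.natAbs, by lia, by rw [Units.val_neg, Units.val_one]; lia⟩
  have h := proj_coeff_hSeries_mem D ε i p
  rw [hSeries, PowerSeries.coeff_mk, dif_neg hp, Subalgebra.mem_comap, map_smul] at h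
  have hc : (((ε : ℤ) : ℂ) * (D.qpow 1 - D.qpow (-1))) ≠ 0 :=
    mul_ne_zero (by exact_mod_cast ε.ne_zero) D.qpow_one_sub_ne_zero
  have := Subalgebra.smul_mem _ h (((ε : ℤ) : ℂ) * (D.qpow 1 - D.qpow (-1)))⁻¹
  rwa [smul_smul, inv_mul_cancel₀ hc, one_smul] at this

/-- The commutation relations are stated for the `φ`, whereas lattice stability is stated for the
subalgebra generated by the `h_{i,m}`. -/
lemma UqCartan_eq_phiAlg : UqCartan D = phiAlg D := by
  refine le_antisymm (Algebra.adjoin_le ?_) (Algebra.adjoin_le ?_)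
  · rintro _ (⟨h, rfl⟩ | ⟨p, rfl⟩)
    exacts [k_mem_phiAlg h, h_mem_phiAlg D p.1 p.2]
  · have hk : ∀ h, Uq.k D h ∈ UqCartan D := fun h => Algebra.subset_adjoin (Or.inl ⟨h, rfl⟩)
    rintro _ (⟨h, rfl⟩ | ⟨⟨ε, i, m⟩, rfl⟩)
    · exact hk h
    · change Uq.phiN D ε i m ∈ UqCartan D
      rw [Uq.phiN_eq]
      refine mul_mem (hk _) ?_
      rw [← Subalgebra.mem_comap]
      have hH : ∀ j < m + 1, PowerSeries.coeff j (hSeries D fh ε i) ∈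
          (UqCartan D).comap (Uq.proj D) := by
        intro j _
        rw [hSeries, PowerSeries.coeff_mk]
        split_ifs with hj
        · exact zero_mem _
        · rw [Subalgebra.mem_comap, map_smul]
          exact Subalgebra.smul_mem _ (show Uq.h D i _ ∈ UqCartan D from
            Algebra.subset_adjoin (Or.inr ⟨(i, _), rfl⟩)) _
      exact sum_mem fun l _ => Subalgebra.smul_mem _ (coeff_pow_mem _ _ _ hH l m (by lia)) _

/-- `U_q(ĝ)` is generated by the `k_h`, `φ^ε_{i, ε m}` and `x^ε_{i, r}`. -/
lemma Uq_induction {S : Submodule ℂ (Uq D)} (h1 : (1 : Uq D) ∈ S)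
    (hphi : ∀ a ∈ phiAlg D, ∀ s ∈ S, a * s ∈ S)
    (hx : ∀ ε i r, ∀ s ∈ S, Uq.x D ε i r * s ∈ S) : S = ⊤ := by
  have key : ∀ a : Free I 𝔥, ∀ s ∈ S, Uq.proj D a * s ∈ S := by
    intro a
    induction a using FreeAlgebra.induction with
    | grade0 c => intro s hs; rw [AlgHom.commutes, ← Algebra.smul_def]; exact S.smul_mem c hs
    | grade1 g =>
      cases g with
      | k h => exact hphi _ (k_mem_phiAlg h)
      | h i m => exact hphi _ (h_mem_phiAlg D i m)
      | x ε i r => exact hx ε i r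
    | mul a b ha hb => intro s hs; rw [map_mul, mul_assoc]; exact ha _ (hb s hs)
    | add a b ha hb => intro s hs; rw [map_add, add_mul]; exact add_mem (ha s hs) (hb s hs)
  rw [eq_top_iff]
  intro y _
  obtain ⟨a, rfl⟩ := Uq.proj_surjective D y
  simpa using key a 1 h1

/-- The span of the `x^ε_{i, r}`. -/
def xs (ε : ℤˣ) : Submodule ℂ (Uq D) :=
  Submodule.span ℂ (Set.range fun p : I × ℤ => Uq.x D ε p.1 p.2)

/-- The subalgebra generated by the `x^ε_{i, r}`. -/
def xAlg (ε : ℤˣ) : Subalgebra ℂ (Uq D) :=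
  Algebra.adjoin ℂ (Set.range fun p : I × ℤ => Uq.x D ε p.1 p.2)

variable {D} in
lemma x_mem_xs (ε : ℤˣ) (i : I) (r : ℤ) : Uq.x D ε i r ∈ xs D ε :=
  Submodule.subset_span ⟨(i, r), rfl⟩

variable {D} in
lemma x_mem_xAlg (ε : ℤˣ) (i : I) (r : ℤ) : Uq.x D ε i r ∈ xAlg D ε :=
  Algebra.subset_adjoin ⟨(i, r), rfl⟩

lemma xs_le_xAlg (ε : ℤˣ) : xs D ε ≤ Subalgebra.toSubmodule (xAlg D ε) := by
  rw [xs, Submodule.span_le]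
  rintro _ ⟨⟨i, r⟩, rfl⟩
  exact x_mem_xAlg ε i r

/-! ### Reordering rules, as inclusions between products of subspaces. -/

open Subalgebra (toSubmodule)

lemma phiAlg_mul_xs_le (ε : ℤˣ) : toSubmodule (phiAlg D) * xs D ε ≤
    xs D ε * toSubmodule (phiAlg D) := by
  have key : ∀ a ∈ phiAlg D, ∀ y ∈ xs D ε, a * y ∈ xs D ε * toSubmodule (phiAlg D) := by
    intro a ha
    induction ha using Algebra.adjoin_induction with
    | mem a ha =>
      intro y hy
      induction hy using Submodule.span_induction with
      | mem y hy =>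
        obtain ⟨⟨j, r⟩, rfl⟩ := hy
        rcases ha with ⟨h, rfl⟩ | ⟨⟨ε', i, m⟩, rfl⟩
        · change Uq.k D h * Uq.x D ε j r ∈ _
          rw [Uq.k_x]
          exact Submodule.smul_mem _ _ (Submodule.mul_mem_mul (x_mem_xs _ _ _) (k_mem_phiAlg h))
        · obtain ⟨g, -, hg⟩ := Uq.exists_phiN_x D ε' ε i j
          change Uq.phiN D ε' i m * Uq.x D ε j r ∈ _
          rw [hg]
          exact sum_mem fun p _ => Submodule.smul_mem _ _
            (Submodule.mul_mem_mul (x_mem_xs _ _ _) (phiN_mem_phiAlg _ _ _))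
      | zero => rw [mul_zero]; exact zero_mem _
      | add y z _ _ hy hz => rw [mul_add]; exact add_mem hy hz
      | smul c y _ hy => rw [mul_smul_comm]; exact Submodule.smul_mem _ _ hy
    | algebraMap c =>
      intro y hy
      rw [Algebra.commutes]
      exact Submodule.mul_mem_mul hy (algebraMap_mem (phiAlg D) c)
    | add a b _ _ ha hb => intro y hy; rw [add_mul]; exact add_mem (ha y hy) (hb y hy)
    | mul a b _ _ ha hb =>
      intro y hy
      rw [mul_assoc]
      refine Submodule.mul_induction_on (hb y hy) (fun z hz c hc => ?_) fun z z' hz hz' => ?_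
      · rw [← mul_assoc]
        have h := Submodule.mul_mem_mul (ha z hz) hc
        rwa [mul_assoc, (Subalgebra.isIdempotentElem_toSubmodule _).eq] at h
      · rw [mul_add]; exact add_mem hz hz'
  exact Submodule.mul_le.2 key

/-- The relation for `φ_m x_r` has leading term a nonzero multiple of `x_r φ_m`, the others
containing `φ` of lower degree. It can therefore be solved for `x_r φ_m`. -/
lemma xs_mul_phiAlg_le (ε : ℤˣ) : xs D ε * toSubmodule (phiAlg D) ≤
    toSubmodule (phiAlg D) * xs D ε := by
  have hphi : ∀ (ε' : ℤˣ) (i j : I) (m : ℕ) (r : ℤ), Uq.x D ε j r * Uq.phiN D ε' i m ∈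
      toSubmodule (phiAlg D) * xs D ε := by
    intro ε' i j m
    obtain ⟨g, hg0, hg⟩ := Uq.exists_phiN_x D ε' ε i j
    induction m using Nat.strong_induction_on with
    | _ m ih =>
      -- The mode `r` stays universally quantified in the induction, since the lower terms shift it.
      intro r
      have h := hg m r
      rw [Finset.sum_range_succ'] at h
      simp only [Nat.cast_zero, mul_zero, add_zero, Nat.sub_zero] at h
      have h1 : g 0 • (Uq.x D ε j r * Uq.phiN D ε' i m) ∈ toSubmodule (phiAlg D) * xs D ε := by
        rw [← sub_eq_iff_eq_add'.2 h]
        refine sub_mem (Submodule.mul_mem_mul (phiN_mem_phiAlg _ _ _) (x_mem_xs _ _ _)) ?_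
        refine sum_mem fun p hp => Submodule.smul_mem _ _ (ih _ ?_ _)
        have := Finset.mem_range.1 hp
        lia
      have h2 := Submodule.smul_mem _ (g 0)⁻¹ h1
      rwa [smul_smul, inv_mul_cancel₀ hg0, one_smul] at h2
  have key : ∀ a ∈ phiAlg D, ∀ y ∈ xs D ε, y * a ∈ toSubmodule (phiAlg D) * xs D ε := by
    intro a ha
    induction ha using Algebra.adjoin_induction with
    | mem a ha =>
      intro y hy
      induction hy using Submodule.span_induction with
      | mem y hy =>
        obtain ⟨⟨j, r⟩, rfl⟩ := hy
        rcases ha with ⟨h, rfl⟩ | ⟨⟨ε', i, m⟩, rfl⟩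
        · change Uq.x D ε j r * Uq.k D h ∈ _
          have h1 := Submodule.smul_mem _ (D.qpow (((ε : ℤ) : ℚ) * D.root j h))⁻¹
            (Submodule.mul_mem_mul
              (show Uq.k D h ∈ toSubmodule (phiAlg D) from k_mem_phiAlg h) (x_mem_xs (D := D) ε j r))
          rwa [Uq.k_x, smul_smul, inv_mul_cancel₀ (D.qpow_ne_zero _), one_smul] at h1
        · exact hphi ε' i j m r
      | zero => rw [zero_mul]; exact zero_mem _
      | add y z _ _ hy hz => rw [add_mul]; exact add_mem hy hz
      | smul c y _ hy => rw [smul_mul_assoc]; exact Submodule.smul_mem _ _ hy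
    | algebraMap c =>
      intro y hy
      rw [← Algebra.commutes]
      exact Submodule.mul_mem_mul (algebraMap_mem (phiAlg D) c) hy
    | add a b _ _ ha hb => intro y hy; rw [mul_add]; exact add_mem (ha y hy) (hb y hy)
    | mul a b _ _ ha hb =>
      intro y hy
      rw [← mul_assoc]
      refine Submodule.mul_induction_on (ha y hy) (fun c hc z hz => ?_) fun z z' hz hz' => ?_
      · rw [mul_assoc]
        have h := Submodule.mul_mem_mul (show c ∈ toSubmodule (phiAlg D) from hc) (hb z hz)
        rwa [← mul_assoc, (Subalgebra.isIdempotentElem_toSubmodule _).eq] at h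
      · rw [add_mul]; exact add_mem hz hz'
  exact Submodule.mul_le.2 fun y hy a ha => key a ha y hy

lemma phiAlg_mul_xAlg_le (ε : ℤˣ) : toSubmodule (phiAlg D) * toSubmodule (xAlg D ε) ≤
    toSubmodule (xAlg D ε) * toSubmodule (phiAlg D) := by
  have key : ∀ b ∈ xAlg D ε, ∀ a ∈ phiAlg D,
      a * b ∈ toSubmodule (xAlg D ε) * toSubmodule (phiAlg D) := by
    intro b hb
    induction hb using Algebra.adjoin_induction with
    | mem b hb =>
      intro a ha
      exact mul_le_mul_left (xs_le_xAlg D ε) _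
        (phiAlg_mul_xs_le D ε (Submodule.mul_mem_mul ha (Submodule.subset_span hb)))
    | algebraMap c =>
      intro a ha
      rw [← Algebra.commutes]
      exact Submodule.mul_mem_mul (algebraMap_mem (xAlg D ε) c) ha
    | add b b' _ _ hb hb' =>
      intro a ha
      rw [mul_add]
      exact add_mem (hb a ha) (hb' a ha)
    | mul b b' _ _ hb hb' =>
      intro a ha
      rw [← mul_assoc]
      refine Submodule.mul_induction_on (hb a ha) (fun c hc z hz => ?_) fun z z' hz hz' => ?_
      · rw [mul_assoc]
        have h := Submodule.mul_mem_mul (show c ∈ toSubmodule (xAlg D ε) from hc) (hb' z hz)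
        rwa [← mul_assoc, (Subalgebra.isIdempotentElem_toSubmodule _).eq] at h
      · rw [add_mul]; exact add_mem hz hz'
  exact Submodule.mul_le.2 fun a ha b hb => key b hb a ha

lemma phi_mem_phiAlg (ε : ℤˣ) (i : I) (m : ℤ) : Uq.phi D ε i m ∈ phiAlg D := by
  by_cases h : 0 ≤ (ε : ℤ) * m
  · have := phiN_mem_phiAlg (D := D) ε i ((ε : ℤ) * m).toNat
    rwa [Uq.phiN, Int.toNat_of_nonneg h, ← mul_assoc, Uq.units_mul_self, one_mul] at this
  · rw [Uq.phi, fphi, phiInt, if_neg h, map_zero]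
    exact zero_mem _

/-- Moving one `x⁺` across a product of `x⁻` either lets it through or replaces it by `φ` terms,
which then move right past the remaining `x⁻`. -/
lemma xs_mul_xAlg_le : xs D 1 * toSubmodule (xAlg D (-1)) ≤
    toSubmodule (xAlg D (-1)) * xs D 1 ⊔
      toSubmodule (xAlg D (-1)) * toSubmodule (phiAlg D) := by
  set N := toSubmodule (xAlg D (-1)) with hN
  set H := toSubmodule (phiAlg D) with hH
  have h1N : (1 : Uq D) ∈ N := one_mem (xAlg D (-1))
  have hNN : N * N = N := (Subalgebra.isIdempotentElem_toSubmodule _).eq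
  have key : ∀ b ∈ xAlg D (-1), ∀ y ∈ xs D 1, y * b ∈ N * xs D 1 ⊔ N * H := by
    intro b hb
    induction hb using Algebra.adjoin_induction with
    | mem b hb =>
      obtain ⟨⟨j, s⟩, rfl⟩ := hb
      intro y hy
      change y * Uq.x D (-1) j s ∈ _
      induction hy using Submodule.span_induction with
      | mem y hy =>
        obtain ⟨⟨i, r⟩, rfl⟩ := hy
        have h := Uq.proj_eq (Rel.x_plus_x_minus (D := D) i j r s)
        rw [map_sub, map_mul, map_mul, sub_eq_iff_eq_add'] at h
        change Uq.x D 1 i r * Uq.x D (-1) j s = Uq.x D (-1) j s * Uq.x D 1 i r + _ at h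
        change Uq.x D 1 i r * Uq.x D (-1) j s ∈ _
        rw [h]
        refine add_mem (Submodule.mem_sup_left
          (Submodule.mul_mem_mul (x_mem_xAlg _ _ _) (x_mem_xs _ _ _))) (Submodule.mem_sup_right ?_)
        rw [← one_mul (Uq.proj D _)]
        refine Submodule.mul_mem_mul h1N ?_
        split_ifs
        · rw [map_smul, map_sub]
          exact H.smul_mem _ (sub_mem (phi_mem_phiAlg D 1 i (r + s))
            (phi_mem_phiAlg D (-1) i (r + s)))
        · rw [map_zero]; exact zero_mem _
      | zero => rw [zero_mul]; exact zero_mem _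
      | add y z _ _ hy hz => rw [add_mul]; exact add_mem hy hz
      | smul c y _ hy => rw [smul_mul_assoc]; exact Submodule.smul_mem _ _ hy
    | algebraMap c =>
      intro y hy
      rw [← Algebra.commutes]
      exact Submodule.mem_sup_left (Submodule.mul_mem_mul (algebraMap_mem (xAlg D (-1)) c) hy)
    | add b b' _ _ hb hb' => intro y hy; rw [mul_add]; exact add_mem (hb y hy) (hb' y hy)
    | mul b b' _ hbm hb hb' =>
      intro y hy
      rw [← mul_assoc]
      -- The factor `b'` is replaced by the line it spans, so that the induction step becomes a
      -- calculation with products of subspaces.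
      have hle : xs D 1 * Submodule.span ℂ {b'} ≤ N * xs D 1 ⊔ N * H := by
        rw [Submodule.mul_le]
        intro z hz w hw
        obtain ⟨c, rfl⟩ := Submodule.mem_span_singleton.1 hw
        rw [mul_smul_comm]
        exact Submodule.smul_mem _ _ (hb' z hz)
      have hle' : Submodule.span ℂ {b'} ≤ N := by
        rw [Submodule.span_singleton_le_iff_mem]; exact hbm
      have h := Submodule.mul_mem_mul (hb y hy) (Submodule.mem_span_singleton_self (R := ℂ) b')
      refine (?_ : (N * xs D 1 ⊔ N * H) * Submodule.span ℂ {b'} ≤ _) h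
      rw [Submodule.sup_mul]
      refine sup_le ?_ ?_
      · rw [mul_assoc]
        calc N * (xs D 1 * Submodule.span ℂ {b'}) ≤ N * (N * xs D 1 ⊔ N * H) :=
              mul_le_mul_right hle _
          _ = N * xs D 1 ⊔ N * H := by rw [Submodule.mul_sup, ← mul_assoc, ← mul_assoc, hNN]
      · rw [mul_assoc]
        calc N * (H * Submodule.span ℂ {b'}) ≤ N * (H * N) :=
              mul_le_mul_right (mul_le_mul_right hle' _) _
          _ ≤ N * (N * H) := mul_le_mul_right (phiAlg_mul_xAlg_le D (-1)) _
          _ = N * H := by rw [← mul_assoc, hNN]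
          _ ≤ _ := le_sup_right
  exact Submodule.mul_le.2 fun y hy b hb => key b hb y hy

/-- The triangular decomposition (surjectivity of the multiplication map). -/
lemma triangular : toSubmodule (xAlg D (-1)) * toSubmodule (phiAlg D) *
    toSubmodule (xAlg D 1) = ⊤ := by
  set N := toSubmodule (xAlg D (-1)) with hN
  set H := toSubmodule (phiAlg D) with hH
  set P := toSubmodule (xAlg D 1) with hP
  have hNN : N * N = N := (Subalgebra.isIdempotentElem_toSubmodule _).eq
  have hHH : H * H = H := (Subalgebra.isIdempotentElem_toSubmodule _).eq
  have hPP : P * P = P := (Subalgebra.isIdempotentElem_toSubmodule _).eq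
  have hxP : xs D 1 * P ≤ P := (mul_le_mul_left (xs_le_xAlg D 1) _).trans hPP.le
  have hxN : xs D (-1) * N ≤ N := (mul_le_mul_left (xs_le_xAlg D (-1)) _).trans hNN.le
  -- The product `N H P` contains `1` and is shown to be stable under left multiplication by each
  -- kind of generator.
  have hphi : H * (N * H * P) ≤ N * H * P := by
    calc H * (N * H * P) = H * N * (H * P) := by simp only [mul_assoc]
      _ ≤ N * H * (H * P) := mul_le_mul_left (phiAlg_mul_xAlg_le D (-1)) _
      _ = N * (H * H) * P := by simp only [mul_assoc]
      _ = N * H * P := by rw [hHH]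
  have hm : xs D (-1) * (N * H * P) ≤ N * H * P := by
    rw [← mul_assoc, ← mul_assoc]
    exact mul_le_mul_left (mul_le_mul_left hxN _) _
  have hp : xs D 1 * (N * H * P) ≤ N * H * P := by
    calc xs D 1 * (N * H * P) = xs D 1 * N * (H * P) := by simp only [mul_assoc]
      _ ≤ (N * xs D 1 ⊔ N * H) * (H * P) := mul_le_mul_left (xs_mul_xAlg_le D) _
      _ = N * (xs D 1 * H) * P ⊔ N * (H * H) * P := by
          rw [Submodule.sup_mul]; simp only [mul_assoc]
      _ ≤ N * (H * xs D 1) * P ⊔ N * H * P := by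
          rw [hHH]
          exact sup_le_sup_right (mul_le_mul_left (mul_le_mul_right (xs_mul_phiAlg_le D 1) _) _) _
      _ = N * H * (xs D 1 * P) ⊔ N * H * P := by simp only [mul_assoc]
      _ ≤ N * H * P := sup_le (mul_le_mul_right hxP _) le_rfl
  refine Uq_induction D ?_ ?_ ?_
  · have := Submodule.mul_mem_mul (Submodule.mul_mem_mul
      (show (1 : Uq D) ∈ N from one_mem (xAlg D (-1)))
      (show (1 : Uq D) ∈ H from one_mem (phiAlg D)))
      (show (1 : Uq D) ∈ P from one_mem (xAlg D 1))
    simpa using this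
  · exact fun a ha s hs => hphi (Submodule.mul_mem_mul ha hs)
  · intro ε i r s hs
    rcases Int.units_eq_one_or ε with rfl | rfl
    · exact hp (Submodule.mul_mem_mul (x_mem_xs _ _ _) hs)
    · exact hm (Submodule.mul_mem_mul (x_mem_xs _ _ _) hs)

end

/-! ## Exponential polynomial sequences -/

section recurrence

variable {R M : Type*} [CommRing R] [AddCommGroup M] [Module R M]

/-- The shift operator on sequences indexed by `ℤ`. -/
def shift (R M : Type*) [CommRing R] [AddCommGroup M] [Module R M] : Module.End R (ℤ → M) :=
  LinearMap.funLeft R M fun n => n + 1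

lemma shift_apply (b : ℤ → M) (n : ℤ) : shift R M b n = b (n + 1) := rfl

lemma aeval_shift_mem (P : Polynomial R) (E : Submodule R M) {b : ℤ → M} {r : ℤ}
    (hb : ∀ n, r ≤ n → b n ∈ E) : ∀ n, r ≤ n → Polynomial.aeval (shift R M) P b n ∈ E := by
  induction P using Polynomial.induction_on' with
  | add p q hp hq =>
    intro n hn
    rw [map_add, LinearMap.add_apply, Pi.add_apply]
    exact add_mem (hp n hn) (hq n hn)
  | monomial k a =>
    rw [Polynomial.aeval_monomial]
    intro n hn
    rw [Module.End.mul_apply, Module.algebraMap_end_apply, Pi.smul_apply]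
    refine E.smul_mem a ?_
    induction k generalizing n with
    | zero => simpa using hb n hn
    | succ k ih =>
      rw [pow_succ', Module.End.mul_apply, shift_apply]
      exact ih (n + 1) (by lia)

/-- A recurrence with invertible constant coefficient determines each term from the later ones,
modulo `E`. Membership thus propagates from large indices down to `r`. -/
lemma mem_of_aeval_shift_mem (P : Polynomial R) (hP : IsUnit (P.coeff 0)) (E : Submodule R M)
    {b : ℤ → M} {r r' : ℤ} (hb : ∀ n, r' ≤ n → b n ∈ E)
    (hPb : ∀ n, r ≤ n → Polynomial.aeval (shift R M) P b n ∈ E) : ∀ n, r ≤ n → b n ∈ E := by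
  have key : ∀ j : ℕ, ∀ n, r ≤ n → r' - j ≤ n → b n ∈ E := by
    intro j
    induction j with
    | zero => exact fun n _ hn => hb n (by simpa using hn)
    | succ j ih =>
      intro n hrn hn
      -- In `P = X * divX P + P(0)`, the first part involves only indices from `n + 1` on, where
      -- membership is known.
      have h1 := aeval_shift_mem P.divX E (b := b) (r := n + 1)
        (fun n' hn' => ih n' (by lia) (by push_cast at hn; lia)) (n + 1) le_rfl
      have h2 := hPb n hrn
      rw [← Polynomial.divX_mul_X_add P, mul_comm, map_add, map_mul, Polynomial.aeval_X,
        Polynomial.aeval_C, LinearMap.add_apply, Pi.add_apply, Module.End.mul_apply, shift_apply,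
        Module.algebraMap_end_apply, Pi.smul_apply, E.add_mem_iff_right h1] at h2
      obtain ⟨c, hc⟩ := hP.exists_left_inv
      have := E.smul_mem c h2
      rwa [smul_smul, hc, one_smul] at this
  intro n hn
  exact key (r' - n).toNat n hn (by lia)

/-- On `z ^ m G(m)`, the operator `shift - z` acts as the forward difference of `G` times an extra
factor `z`. Polynomial factors are hence killed by a high enough power. -/
lemma sub_pow_shift_apply (z : R) (r : ℤ) (F : M) (l : ℕ) (G : R → R) (s : ℤ → M)
    (hs : ∀ m : ℕ, s (r + m) = (z ^ m * G m) • F) (m : ℕ) :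
    Polynomial.aeval (shift R M) ((Polynomial.X - Polynomial.C z) ^ l) s (r + m) =
      (z ^ (m + l) * (fwdDiff 1)^[l] G m) • F := by
  induction l generalizing m with
  | zero => simpa using hs m
  | succ l ih =>
    rw [pow_succ', map_mul, Module.End.mul_apply, map_sub, Polynomial.aeval_X, Polynomial.aeval_C,
      LinearMap.sub_apply, Pi.sub_apply, shift_apply, Module.algebraMap_end_apply, Pi.smul_apply,
      ih, add_assoc, ← Nat.cast_succ, ih, smul_smul, ← sub_smul, Function.iterate_succ_apply',
      fwdDiff]
    congr 1
    rw [Nat.succ_eq_add_one]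
    push_cast
    ring

/-- The sequence `a` agrees from `r` on with a finite sum of sequences `z ^ m m ^ k F`. -/
def IsExpPoly (R : Type*) {M : Type*} [CommRing R] [AddCommGroup M] [Module R M]
    (a : ℤ → M) (r : ℤ) (E : Submodule R M) : Prop :=
  ∃ (T : Finset (ℕ × ℕ × ℂˣ)) (z : ℕ × ℕ × ℂˣ → Rˣ) (k : ℕ × ℕ × ℂˣ → ℕ) (F : ℕ × ℕ × ℂˣ → M),
    E = Submodule.span R (F '' T) ∧
    ∀ m : ℕ, a (r + m) = ∑ t ∈ T, ((z t : R) ^ m * (m : R) ^ k t) • F t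

lemma IsExpPoly.mem {a : ℤ → M} {r : ℤ} {E : Submodule R M} (h : IsExpPoly R a r E) :
    ∀ n, r ≤ n → a n ∈ E := by
  obtain ⟨T, z, k, F, rfl, h⟩ := h
  intro n hn
  obtain ⟨m, rfl⟩ := Int.le.dest hn
  rw [h m]
  exact sum_mem fun t ht => Submodule.smul_mem _ _ (Submodule.subset_span ⟨t, ht, rfl⟩)

/-- Each term `z ^ m m ^ k F` is annihilated by `(X - z) ^ (k + 1)`. The product of these
polynomials has a unit constant coefficient because every `z` is a unit. -/
lemma IsExpPoly.exists_annihilator {a : ℤ → M} {r : ℤ} {E : Submodule R M}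
    (h : IsExpPoly R a r E) : ∃ P : Polynomial R, IsUnit (P.coeff 0) ∧
      ∀ n, r ≤ n → Polynomial.aeval (shift R M) P a n = 0 := by
  classical
  obtain ⟨T, z, k, F, -, h⟩ := h
  refine ⟨∏ t ∈ T, (Polynomial.X - Polynomial.C (z t : R)) ^ (k t + 1), ?_, ?_⟩
  · rw [Polynomial.coeff_zero_prod]
    refine Finset.prod_induction _ IsUnit (fun _ _ => IsUnit.mul) isUnit_one fun t _ => ?_
    rw [Polynomial.coeff_zero_eq_eval_zero, Polynomial.eval_pow]
    refine IsUnit.pow _ ?_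
    simp
  · set s : ℕ × ℕ × ℂˣ → ℤ → M := fun t n =>
      ((z t : R) ^ (n - r).toNat * ((n - r).toNat : R) ^ k t) • F t with hs
    have hterm : ∀ t ∈ T, ∀ n, r ≤ n → Polynomial.aeval (shift R M)
        (∏ t ∈ T, (Polynomial.X - Polynomial.C (z t : R)) ^ (k t + 1)) (s t) n = 0 := by
      intro t ht n hn
      rw [← Finset.prod_erase_mul _ _ ht, map_mul, Module.End.mul_apply, ← Submodule.mem_bot R]
      refine aeval_shift_mem _ _ (r := r) (fun n hn => ?_) n hn
      obtain ⟨m, rfl⟩ := Int.le.dest hn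
      rw [Submodule.mem_bot, sub_pow_shift_apply (z t : R) r (F t) (k t + 1) (fun x => x ^ k t)
        (s t) (fun m => by simp [hs]), fwdDiff_iter_pow_eq_zero_of_lt (Nat.lt_succ_self _)]
      simp
    intro n hn
    -- The expansion is valid only from `r` on; the shift looks forward, so what happens before `r`
    -- is irrelevant.
    have h0 : ∀ n, r ≤ n → (a - ∑ t ∈ T, s t) n ∈ (⊥ : Submodule R M) := by
      intro n hn
      obtain ⟨m, rfl⟩ := Int.le.dest hn
      simp [h m, hs]
    have h1 := aeval_shift_mem (∏ t ∈ T, (Polynomial.X - Polynomial.C (z t : R)) ^ (k t + 1)) ⊥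
      h0 n hn
    rw [map_sub, map_sum, Pi.sub_apply, Finset.sum_apply,
      Finset.sum_eq_zero (fun t ht => hterm t ht n hn), sub_zero, Submodule.mem_bot] at h1
    exact h1

/-- A sequence indexed by `ℤ` which is exponential polynomial from each index on takes its values
in a finitely generated submodule. -/
lemma exists_fg_of_isExpPoly {a : ℤ → M} (h : ∀ r, ∃ E, IsExpPoly R a r E) :
    ∃ E : Submodule R M, E.FG ∧ ∀ n, a n ∈ E := by
  obtain ⟨E, hE⟩ := h 0
  obtain ⟨P, hP, hPa⟩ := hE.exists_annihilator
  -- The recurrence found from index `0` holds at every index: `P(shift) a` vanishes for large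
  -- indices and, from `n` on, satisfies another invertible recurrence `P'`, so it vanishes from `n`
  -- on.
  have hzero : ∀ n, Polynomial.aeval (shift R M) P a n = 0 := by
    intro n
    obtain ⟨E', hE'⟩ := h n
    obtain ⟨P', hP', hPa'⟩ := hE'.exists_annihilator
    rw [← Submodule.mem_bot R]
    refine mem_of_aeval_shift_mem P' hP' ⊥ (b := Polynomial.aeval (shift R M) P a) (r := n)
      (r' := 0) (fun n hn => by simpa using hPa n hn) (fun m hm => ?_) n le_rfl
    rw [← Module.End.mul_apply, ← map_mul, mul_comm, map_mul, Module.End.mul_apply]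
    exact aeval_shift_mem P ⊥ (fun n hn => by simpa using hPa' n hn) m hm
  refine ⟨E, ?_, fun n => mem_of_aeval_shift_mem P hP E hE.mem
    (fun n _ => by rw [hzero]; exact zero_mem _) n (le_refl n)⟩
  obtain ⟨T, z, k, F, rfl, -⟩ := hE
  exact Submodule.fg_span (T.finite_toSet.image F)

end recurrence

/-! ## Weight spaces of the objects of `Mod(U'_q(ĝ))` -/

section

variable {I : Type*} [Fintype I] [DecidableEq I] {𝔥 : Type*} [AddCommGroup 𝔥] [Module ℚ 𝔥]
  (D : Datum I 𝔥)

section modules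

variable {M : Type*} [AddCommGroup M] [Module (UqCu D) M] [Module Cu M]
  [IsScalarTower Cu (UqCu D) M]

lemma incl_smul_comm (c : Cu) (a : Uq D) (v : M) : incl D a • c • v = c • incl D a • v :=
  map_smul (act D M a) c v

variable [Module ℂ M] [IsScalarTower ℂ Cu M] [IsScalarTower ℂ (UqCu D) M]

lemma mem_weightSpaceCu {ω : Module.Dual ℚ 𝔥} {v : M} :
    v ∈ weightSpaceCu D M ω ↔ ∀ h, incl D (Uq.k D h) • v = D.qpow (ω h) • v := by
  change (∀ h, incl D (Uq.k D h) • v = algebraMap ℂ Cu (D.qpow (ω h)) • v) ↔ _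
  simp only [algebraMap_smul]

lemma mem_weightSpace_kActC {ω : Module.Dual ℚ 𝔥} {v : M} :
    v ∈ weightSpace D (kActC D M) ω ↔ v ∈ weightSpaceCu D M ω := by
  rw [mem_weightSpaceCu]
  rfl

lemma x_smul_mem {ω : Module.Dual ℚ 𝔥} {v : M} (hv : v ∈ weightSpaceCu D M ω) (ε : ℤˣ) (i : I)
    (r : ℤ) : incl D (Uq.x D ε i r) • v ∈ weightSpaceCu D M (ω + (ε : ℤ) • D.root i) := by
  rw [mem_weightSpaceCu] at hv ⊢
  intro h
  have hq : D.qpow ((ω + (ε : ℤ) • D.root i) h) =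
      D.qpow (((ε : ℤ) : ℚ) * D.root i h) * D.qpow (ω h) := by
    simp only [Datum.qpow, LinearMap.add_apply, LinearMap.smul_apply, zsmul_eq_mul,
      Rat.cast_add, add_mul, Complex.exp_add]
    rw [mul_comm]
  rw [← mul_smul, ← map_mul, Uq.k_x, map_smul, smul_assoc, map_mul, mul_smul, hv h, hq, mul_smul,
    ← algebraMap_smul Cu (D.qpow (ω h)), incl_smul_comm, algebraMap_smul]

lemma phiAlg_smul_mem {ω : Module.Dual ℚ 𝔥} {v : M} (hv : v ∈ weightSpaceCu D M ω) {a : Uq D}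
    (ha : a ∈ phiAlg D) : incl D a • v ∈ weightSpaceCu D M ω := by
  have hcomm : phiAlg D ≤ Subalgebra.centralizer ℂ (Set.range (Uq.k D)) := by
    refine Algebra.adjoin_le ?_
    rintro _ (⟨h, rfl⟩ | ⟨⟨ε, i, m⟩, rfl⟩)
    · rintro _ ⟨h', rfl⟩
      rw [Uq.k_add, Uq.k_add, add_comm]
    · rintro _ ⟨h', rfl⟩
      exact Uq.k_phiN D h' ε i m
  rw [mem_weightSpaceCu] at hv ⊢
  intro h
  rw [← mul_smul, ← map_mul, hcomm ha _ ⟨h, rfl⟩, map_mul, mul_smul, hv h,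
    ← algebraMap_smul Cu (D.qpow (ω h)), incl_smul_comm, algebraMap_smul]

/-- The weight space of weight `ω` of a `ℂ`-subspace. -/
abbrev wtPart (W : Submodule ℂ M) (ω : Module.Dual ℚ 𝔥) : Submodule ℂ M :=
  W ⊓ weightSpace D (kActC D M) ω

lemma wtPart_subset (W : Submodule ℂ M) (ω : Module.Dual ℚ 𝔥) :
    (wtPart D W ω : Set M) ⊆ weightSpaceCu D M ω :=
  fun _ hv => (mem_weightSpace_kActC D).1 hv.2

/-- If a set is contained in the span of subsets of weight vectors, then the weight vectors in its
span are in the span of the corresponding subset. -/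
lemma mem_span_of_mem_weightSpaceCu {R : Type*} [Semiring R] [Module R M]
    (hR : ∀ (ω : Module.Dual ℚ 𝔥) (r : R) (v : M), v ∈ weightSpaceCu D M ω →
      r • v ∈ weightSpaceCu D M ω)
    {W : Set M} {W' : Module.Dual ℚ 𝔥 → Set M} (hW' : ∀ ω, W' ω ⊆ weightSpaceCu D M ω)
    (hW : W ⊆ (⨆ ω, Submodule.span R (W' ω) : Submodule R M))
    {ω : Module.Dual ℚ 𝔥} {v : M} (hv : v ∈ Submodule.span R W) (hvω : v ∈ weightSpaceCu D M ω) :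
    v ∈ Submodule.span R (W' ω) := by
  have h1 : v ∈ ⨆ ω, Submodule.span R (W' ω) := Submodule.span_le.2 hW hv
  have h2 : ∀ ω, ∀ x ∈ Submodule.span R (W' ω), x ∈ weightSpaceCu D M ω := by
    intro ω x hx
    induction hx using Submodule.span_induction with
    | mem x hx => exact hW' ω hx
    | zero => exact zero_mem _
    | add x y _ _ hx hy => exact add_mem hx hy
    | smul r x _ hx => exact hR ω r x hx
  obtain ⟨f, hf, hsum⟩ := (Submodule.mem_iSup_iff_exists_finsupp _ _).1 h1
  have h3 := eq_component_of_mem_weightSpace D (fun h => act D M (Uq.k D h)) f.support f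
    (fun ω _ => h2 ω _ (hf ω)) hvω hsum
  by_cases h : ω ∈ f.support
  · rw [h3.1 h]
    exact hf ω
  · rw [h3.2 h]
    exact zero_mem _

namespace IsGenerating

variable {D} {W : Submodule ℂ M} (hW : IsGenerating D W)

include hW

lemma exists_sum {w : M} (hw : w ∈ W) : w ∈ ⨆ ω, wtPart D W ω := by
  rwa [hW.cartan.iSup_eq]

lemma subset_iSup_span (R : Type*) [Semiring R] [Module R M] :
    (W : Set M) ⊆ (⨆ ω, Submodule.span R (wtPart D W ω : Set M) : Submodule R M) := by
  intro w hw
  obtain ⟨f, hf, rfl⟩ := (Submodule.mem_iSup_iff_exists_finsupp _ _).1 (hW.exists_sum hw)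
  exact sum_mem fun ω _ => Submodule.mem_iSup_of_mem ω (Submodule.subset_span (hf ω))

lemma span_eq_top : Submodule.span Cu (W : Set M) = ⊤ := by
  rw [eq_top_iff]
  rintro v -
  obtain ⟨t, rfl⟩ := hW.bijective.2 v
  induction t using TensorProduct.induction_on with
  | zero => rw [map_zero]; exact zero_mem _
  | tmul c w =>
    rw [LinearMap.liftBaseChange_tmul]
    exact Submodule.smul_mem _ _ (Submodule.subset_span w.2)
  | add x y hx hy => rw [map_add]; exact add_mem hx hy

lemma weightSpaceCu_eq_span (ω : Module.Dual ℚ 𝔥) :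
    weightSpaceCu D M ω = Submodule.span Cu (wtPart D W ω : Set M) := by
  refine le_antisymm (fun v hv => ?_) (Submodule.span_le.2 (wtPart_subset D W ω))
  refine mem_span_of_mem_weightSpaceCu D (fun ω r v hv => Submodule.smul_mem _ r hv)
    (wtPart_subset D W) (hW.subset_iSup_span Cu) ?_ hv
  rw [hW.span_eq_top]
  trivial

lemma iSup_weightSpaceCu : ⨆ ω, weightSpaceCu D M ω = ⊤ := by
  rw [eq_top_iff, ← hW.span_eq_top, Submodule.span_le]
  simp only [hW.weightSpaceCu_eq_span]
  exact hW.subset_iSup_span Cu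

/-- This holds for any coefficient ring between `ℂ` and `ℂ(u)`, since `W` splits into weight parts
and weights are independent over `ℂ(u)`. -/
lemma mem_span_subalgebra (R : Subalgebra ℂ Cu) {ω : Module.Dual ℚ 𝔥} {v : M}
    (hv : v ∈ Submodule.span R (W : Set M)) (hvω : v ∈ weightSpaceCu D M ω) :
    v ∈ Submodule.span R (wtPart D W ω : Set M) :=
  mem_span_of_mem_weightSpaceCu D (R := R)
    (fun ω r _ hv => Submodule.smul_mem (weightSpaceCu D M ω) (r : Cu) hv)
    (wtPart_subset D W) (hW.subset_iSup_span R) hv hvω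

lemma fg_span_wtPart (R : Subalgebra ℂ Cu) (ω : Module.Dual ℚ 𝔥) :
    (Submodule.span R (wtPart D W ω : Set M)).FG := by
  have := hW.cartan.finite ω
  obtain ⟨s, hs⟩ := (Submodule.fg_iff_finiteDimensional (wtPart D W ω)).2 this
  refine ⟨s, ?_⟩
  rw [← hs, Submodule.span_span_of_tower]

lemma weightSpaceCu_eq_bot_iff (ω : Module.Dual ℚ 𝔥) :
    weightSpaceCu D M ω = ⊥ ↔ wtPart D W ω = ⊥ := by
  rw [hW.weightSpaceCu_eq_span, Submodule.span_eq_bot, Submodule.eq_bot_iff]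
  rfl

/-- The operators `x^±_{i, r ± m}` on the whole weight space. -/
lemma exists_regular (ω : Module.Dual ℚ 𝔥) (ε : ℤˣ) (i : I) (r : ℤ) :
    ∃ (S : Finset (ℕ × ℕ × ℂˣ)) (F : ℕ × ℕ × ℂˣ → Module.End Cu M),
      ∀ (m : ℕ), ∀ y ∈ weightSpaceCu D M ω, incl D (Uq.x D ε i (r + (ε : ℤ) * m)) • y =
        ∑ t ∈ S, (algebraMap ℂ Cu ((t.2.2 : ℂ) ^ m) * (RatFunc.X : Cu) ^ (t.1 * m) *
            (m : Cu) ^ t.2.1) • F t y := by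
  obtain ⟨S, f, hf⟩ := hW.regular ω ε i r
  -- The map is extended `ℂ`-linearly from the weight part to `W`, then `ℂ(u)`-linearly to `M`,
  -- which is the base change of `W`.
  have hext : ∀ t, ∃ F : Module.End Cu M, ∀ w : wtPart D W ω, F w = f t w := by
    intro t
    obtain ⟨g, hg⟩ := LinearMap.exists_extend (f t)
    refine ⟨(LinearMap.liftBaseChange Cu (g ∘ₗ W.subtype)) ∘ₗ
      (LinearEquiv.ofBijective _ hW.bijective).symm.toLinearMap, fun w => ?_⟩
    have h1 : (LinearEquiv.ofBijective _ hW.bijective).symm (w : M) =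
        (1 : Cu) ⊗ₜ[ℂ] (⟨w, w.2.1⟩ : W) := by
      rw [LinearEquiv.symm_apply_eq, LinearEquiv.ofBijective_apply,
        LinearMap.liftBaseChange_one_tmul]
      rfl
    rw [LinearMap.comp_apply, LinearEquiv.coe_coe, h1, LinearMap.liftBaseChange_one_tmul,
      ← hg]
    rfl
  choose F hF using hext
  refine ⟨S, F, fun m y hy => ?_⟩
  rw [hW.weightSpaceCu_eq_span] at hy
  induction hy using Submodule.span_induction with
  | mem w hw =>
    rw [hf m ⟨w, hw⟩]
    exact Finset.sum_congr rfl fun t _ => by rw [← hF t ⟨w, hw⟩]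
  | zero => simp
  | add y z _ _ hy hz => simp only [smul_add, hy, hz, map_add, Finset.sum_add_distrib]
  | smul c y _ hy =>
    rw [incl_smul_comm, hy, Finset.smul_sum]
    exact Finset.sum_congr rfl fun t _ => by rw [map_smul, smul_comm]

/-- The vectors `x^ε_{i, r} y`, for all `r`, lie in a finitely generated `𝒜`-submodule. -/
lemma exists_fg_x_smul {ω : Module.Dual ℚ 𝔥} {y : M} (hy : y ∈ weightSpaceCu D M ω) (ε : ℤˣ)
    (i : I) : ∃ E : Submodule 𝒜 M, E.FG ∧ ∀ r, incl D (Uq.x D ε i r) • y ∈ E := by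
  obtain ⟨u, hu⟩ := exists_unit_X
  obtain ⟨E, hE, hE'⟩ := exists_fg_of_isExpPoly (R := 𝒜)
      -- Indexing by `ε n` turns the modes `r ± m` into a forward half line for both signs.
      (a := fun n : ℤ => incl D (Uq.x D ε i ((ε : ℤ) * n)) • y) (by
    intro r
    obtain ⟨S, F, hF⟩ := hW.exists_regular ω ε i ((ε : ℤ) * r)
    -- The base is `λ u ^ k`, a unit of `𝒜` because `u` is invertible at `u = 1`.
    refine ⟨_, S, fun t => Units.map (algebraMap ℂ 𝒜 : ℂ →* 𝒜) t.2.2 * u ^ t.1,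
      fun t => t.2.1, fun t => F t y, rfl, fun m => ?_⟩
    beta_reduce
    rw [mul_add, hF m y hy]
    refine Finset.sum_congr rfl fun t _ => ?_
    change _ = ((_ : 𝒜) : Cu) • F t y
    congr 1
    push_cast
    rw [hu, mul_pow, ← pow_mul]
    rfl)
  refine ⟨E, hE, fun r => ?_⟩
  have := hE' ((ε : ℤ) * r)
  rwa [← mul_assoc, Uq.units_mul_self, one_mul] at this

/-- The orbit of a weight vector under `U_q(ĥ)` lies in a finitely generated `𝒜`-submodule. -/
lemma exists_fg_cartan_smul {ω : Module.Dual ℚ 𝔥} {y : M} (hy : y ∈ weightSpaceCu D M ω) :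
    ∃ E : Submodule 𝒜 M, E.FG ∧ ∀ a ∈ phiAlg D, incl D a • y ∈ E := by
  have hy' := hy
  rw [hW.weightSpaceCu_eq_span] at hy'
  clear hy
  induction hy' using Submodule.span_induction with
  | mem w hw =>
    refine ⟨_, hW.fg_span_wtPart 𝒜 ω, fun a ha => ?_⟩
    have h1 : incl D a • w ∈ Submodule.span laurentRing (wtPart D W ω : Set M) :=
      hW.mem_span_subalgebra laurentRing
        (hW.lattice_stable a (by rwa [UqCartan_eq_phiAlg]) w (Submodule.subset_span hw.1))
        (phiAlg_smul_mem D (wtPart_subset D W ω hw) ha)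
    generalize incl D a • w = z at h1
    induction h1 using Submodule.span_induction with
    | mem z hz => exact Submodule.subset_span hz
    | zero => exact zero_mem _
    | add y z _ _ hy hz => exact add_mem hy hz
    | smul c y _ hy =>
      exact Submodule.smul_mem _ (⟨c, laurentRing_le_𝒜 c.2⟩ : 𝒜) hy
  | zero => exact ⟨⊥, Submodule.fg_bot, fun a _ => by rw [smul_zero]; exact zero_mem _⟩
  | add y z _ _ hy hz =>
    obtain ⟨E, hE, hE'⟩ := hy
    obtain ⟨E₂, hE₂, hE₂'⟩ := hz
    refine ⟨E ⊔ E₂, hE.sup hE₂, fun a ha => ?_⟩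
    rw [smul_add]
    exact add_mem (Submodule.mem_sup_left (hE' a ha)) (Submodule.mem_sup_right (hE₂' a ha))
  | smul c y _ hy =>
    obtain ⟨E, hE, hE'⟩ := hy
    -- The scalar `c` may have a pole at `u = 1`, so the module itself is rescaled.
    refine ⟨E.map ((LinearMap.lsmul Cu M c).restrictScalars 𝒜), hE.map _, fun a ha => ?_⟩
    exact ⟨_, hE' a ha, (incl_smul_comm D c a y).symm⟩

end IsGenerating

end modules

end

/-! ## Submodules of the objects of `Mod(U'_q(ĝ))` -/

/-- A finitely generated lattice in a vector space over the fraction field of a principal ideal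
domain has a basis. -/
lemma exists_basis_of_lattice {R K X : Type*} [CommRing R] [IsDomain R] [IsPrincipalIdealRing R]
    [Field K] [Algebra R K] [IsFractionRing R K] [AddCommGroup X] [Module R X] [Module K X]
    [IsScalarTower R K X] (A : Submodule K X) (L : Submodule R X) (hL : L.FG)
    (hLA : ∀ x ∈ L, x ∈ A) (hA : ∀ x ∈ A, ∃ p : R, p ≠ 0 ∧ p • x ∈ L) :
    ∃ (d : ℕ) (b : Module.Basis (Fin d) K A), (∀ j, (b j : X) ∈ L) ∧
      L ≤ Submodule.span R (Set.range fun j => (b j : X)) := by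
  have hfin : Module.Finite R L := Module.Finite.iff_fg.2 hL
  have htf : Module.IsTorsionFree R X := .trans_faithfulSMul R K X
  let e := Module.finBasis R L
  let v : Fin _ → A := fun j => ⟨e j, hLA _ (e j).2⟩
  have hli : LinearIndependent R v := by
    refine LinearIndependent.of_comp (A.subtype.restrictScalars R) ?_
    exact e.linearIndependent.map' L.subtype (Submodule.ker_subtype _)
  have hspan : L ≤ Submodule.span R (Set.range fun j => (v j : X)) := by
    intro n hn
    have h1 : (⟨n, hn⟩ : L) ∈ Submodule.span R (Set.range e) := by
      rw [e.span_eq]; trivial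
    have h2 := Submodule.mem_map_of_mem (f := L.subtype) h1
    rwa [Submodule.map_span, ← Set.range_comp] at h2
  have htop : ⊤ ≤ Submodule.span K (Set.range v) := by
    rintro ⟨n, hn⟩ -
    obtain ⟨p, hp, hpn⟩ := hA n hn
    have h3 : algebraMap R K p • n ∈ Submodule.span K (Set.range fun j => (v j : X)) := by
      rw [algebraMap_smul]
      exact Submodule.span_le_restrictScalars R K _ (hspan hpn)
    have hp0 : algebraMap R K p ≠ 0 := by simpa using hp
    have h5 := Submodule.smul_mem _ (algebraMap R K p)⁻¹ h3
    rw [smul_smul, inv_mul_cancel₀ hp0, one_smul] at h5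
    have h6 : Submodule.map A.subtype (Submodule.span K (Set.range v)) =
        Submodule.span K (Set.range fun j => (v j : X)) := by
      rw [Submodule.map_span, ← Set.range_comp]; rfl
    rw [← h6] at h5
    obtain ⟨y, hy, rfl⟩ := h5
    exact hy
  refine ⟨_, Module.Basis.mk ((LinearIndependent.iff_fractionRing R K).1 hli) htop, ?_, ?_⟩
  · intro j
    rw [Module.Basis.mk_apply]
    exact (e j).2
  · simpa only [Module.Basis.mk_apply] using hspan

section

variable {I : Type*} [Fintype I] [DecidableEq I] {𝔥 : Type*} [AddCommGroup 𝔥] [Module ℚ 𝔥]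
  (D : Datum I 𝔥)

lemma exists_smul_mem_span_laurentRing {M : Type*} [AddCommGroup M] [Module Cu M] {s : Set M}
    {v : M} (hv : v ∈ Submodule.span Cu s) :
    ∃ p : laurentRing, p ≠ 0 ∧ p • v ∈ Submodule.span laurentRing s := by
  induction hv using Submodule.span_induction with
  | mem v hv => exact ⟨1, one_ne_zero, by rw [one_smul]; exact Submodule.subset_span hv⟩
  | zero => exact ⟨1, one_ne_zero, by rw [smul_zero]; exact zero_mem _⟩
  | add v w _ _ hv hw =>
    obtain ⟨p, hp, hpv⟩ := hv
    obtain ⟨p', hp', hpw⟩ := hw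
    refine ⟨p * p', mul_ne_zero hp hp', ?_⟩
    rw [smul_add]
    refine add_mem ?_ ?_
    · rw [mul_comm, mul_smul]
      exact Submodule.smul_mem _ _ hpv
    · rw [mul_smul]
      exact Submodule.smul_mem _ _ hpw
  | smul c v _ hv =>
    obtain ⟨p, hp, hpv⟩ := hv
    obtain ⟨x, y, hy, rfl⟩ := IsFractionRing.div_surjective (A := laurentRing) c
    refine ⟨y * p, mul_ne_zero (nonZeroDivisors.ne_zero hy) hp, ?_⟩
    have h : (y * p) • (algebraMap laurentRing Cu x / algebraMap laurentRing Cu y) • v =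
        x • p • v := by
      change (y * p : Cu) • ((x : Cu) / (y : Cu)) • v = (x : Cu) • (p : Cu) • v
      have hy0 : (y : Cu) ≠ 0 := by
        simpa using nonZeroDivisors.ne_zero hy
      rw [smul_smul, smul_smul]
      congr 1
      field_simp
    rw [h]
    exact Submodule.smul_mem _ _ hpv

section modules

variable {M : Type*} [AddCommGroup M] [Module (UqCu D) M] [Module Cu M]
  [IsScalarTower Cu (UqCu D) M]

/-- The operators whose generalized eigenvectors are the `(l,u)`-weight vectors. -/
def luOp (M : Type*) [AddCommGroup M] [Module (UqCu D) M] [Module Cu M]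
    [IsScalarTower Cu (UqCu D) M] : 𝔥 ⊕ (ℤˣ × I × ℕ) → Module.End Cu M
  | Sum.inl h => act D M (Uq.k D h)
  | Sum.inr t => act D M (Uq.phi D t.1 t.2.1 ((t.1 : ℤ) * t.2.2))

/-- The eigenvalues of the operators `luOp` for a given `(l,u)`-weight. -/
def luVal (Λ : LUWeight D) : 𝔥 ⊕ (ℤˣ × I × ℕ) → Cu
  | Sum.inl h => algebraMap ℂ Cu (D.qpow (Λ.wt h))
  | Sum.inr t => Λ.Ψ t.1 t.2.1 t.2.2

lemma luVal_separates (Λ Λ' : LUWeight D) (h : Λ ≠ Λ') : ∃ k, luVal D Λ k ≠ luVal D Λ' k := by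
  by_contra! hcon
  have h1 : Λ.wt = Λ'.wt := by
    by_contra hne
    obtain ⟨x, hx⟩ := weight_separates D Cu _ _ hne
    exact hx (hcon (Sum.inl x))
  have h2 : Λ.Ψ = Λ'.Ψ := by
    funext ε i m
    exact Subtype.ext (hcon (Sum.inr (ε, i, m)))
  obtain ⟨wt, Ψ, _⟩ := Λ
  obtain ⟨wt', Ψ', _⟩ := Λ'
  obtain rfl : wt = wt' := h1
  obtain rfl : Ψ = Ψ' := h2
  exact h rfl

variable {D} in
lemma luWeightSpace_pow {Λ : LUWeight D} {v : M} (hv : v ∈ luWeightSpace D M Λ) :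
    ∃ p : ℕ, ∀ k, ((luOp D M k - algebraMap Cu (Module.End Cu M) (luVal D Λ k)) ^ p) v = 0 := by
  obtain ⟨h1, p, hp⟩ := hv
  refine ⟨p + 1, ?_⟩
  rintro (h | ⟨ε, i, m⟩)
  · refine pow_apply_eq_zero_of_le (Nat.le_add_left 1 p) ?_
    rw [pow_one, LinearMap.sub_apply, Module.algebraMap_end_apply, sub_eq_zero]
    exact h1 h
  · exact pow_apply_eq_zero_of_le (Nat.le_add_right p 1) (hp ε i m)

/-- Independence holds in every module; only the spanning condition has to be inherited by
submodules. -/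
lemma luWeightSpace_iSupIndep : iSupIndep (luWeightSpace D M) := by
  rw [iSupIndep_iff_finsetSum_eq_zero_imp_eq_zero]
  intro S v hv h0
  exact eq_zero_of_sum_eq_zero (luOp D M) (luVal D) (luVal_separates D) S v
    (fun Λ hΛ => luWeightSpace_pow (hv Λ hΛ)) h0

/-! ### Inheritance of the decompositions by a submodule. -/

variable (N : Submodule (UqCu D) M)

lemma coe_act_pow (a : Uq D) (c : Cu) (p : ℕ) (n : N) :
    ((((act D N a - algebraMap Cu (Module.End Cu N) c) ^ p) n : N) : M) =
      ((act D M a - algebraMap Cu (Module.End Cu M) c) ^ p) (n : M) := by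
  induction p generalizing n with
  | zero => rfl
  | succ p ih =>
    rw [pow_succ, pow_succ, Module.End.mul_apply, Module.End.mul_apply, ih]
    rfl

lemma coe_mem_weightSpaceCu {ω : Module.Dual ℚ 𝔥} {n : N} :
    (n : M) ∈ weightSpaceCu D M ω ↔ n ∈ weightSpaceCu D N ω :=
  forall_congr' fun h => (Subtype.ext_iff (a1 := act D N (Uq.k D h) n)
    (a2 := algebraMap ℂ Cu (D.qpow (ω h)) • n)).symm

lemma coe_mem_luWeightSpace {Λ : LUWeight D} {n : N} :
    (n : M) ∈ luWeightSpace D M Λ ↔ n ∈ luWeightSpace D N Λ := by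
  refine and_congr (coe_mem_weightSpaceCu D N) (exists_congr fun p => forall_congr' fun ε =>
    forall_congr' fun i => forall_congr' fun m => ?_)
  rw [← coe_act_pow, ZeroMemClass.coe_eq_zero]

/-- If the weight spaces, or the `(l,u)`-weight spaces, span `M`, then they span each of its
submodules. -/
lemma iSup_eq_top_of_separates {ι κ : Type*} (T : κ → Uq D) (a : ι → κ → Cu)
    (sep : ∀ i j, i ≠ j → ∃ k, a i k ≠ a j k) (A : ι → Submodule Cu M) (A' : ι → Submodule Cu N)
    (hA : ∀ i, ∀ v ∈ A i, ∃ p : ℕ, ∀ k,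
      ((act D M (T k) - algebraMap Cu (Module.End Cu M) (a i k)) ^ p) v = 0)
    (hA' : ∀ i, ∀ n : N, (n : M) ∈ A i → n ∈ A' i) (htop : ⨆ i, A i = ⊤) : ⨆ i, A' i = ⊤ := by
  rw [eq_top_iff]
  rintro ⟨n, hn⟩ -
  have h1 : n ∈ ⨆ i, A i := by rw [htop]; trivial
  obtain ⟨f, hf, hsum⟩ := (Submodule.mem_iSup_iff_exists_finsupp _ _).1 h1
  have h2 : ∀ i ∈ f.support, f i ∈ N.restrictScalars Cu :=
    mem_of_sum_mem (fun k => act D M (T k)) a sep (N.restrictScalars Cu)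
      (fun k x hx => N.smul_mem _ hx) f.support f (fun i _ => hA i _ (hf i)) (by
        change f.sum (fun _ x => x) ∈ N
        rwa [hsum])
  have h3 : ∀ i, f i ∈ N := by
    intro i
    by_cases hi : i ∈ f.support
    · exact h2 i hi
    · rw [Finsupp.notMem_support_iff.1 hi]
      exact zero_mem _
  have h4 : (⟨n, hn⟩ : N) = ∑ i ∈ f.support, (⟨f i, h3 i⟩ : N) := by
    refine Subtype.ext ?_
    rw [AddSubmonoidClass.coe_finsetSum]
    exact hsum.symm
  rw [h4]
  exact sum_mem fun i _ => Submodule.mem_iSup_of_mem i (hA' i _ (hf i))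

lemma iSup_luWeightSpace_submodule (h : ⨆ Λ, luWeightSpace D M Λ = ⊤) :
    ⨆ Λ, luWeightSpace D N Λ = ⊤ := by
  refine iSup_eq_top_of_separates D N (fun k : 𝔥 ⊕ (ℤˣ × I × ℕ) => Sum.elim (fun h => Uq.k D h)
    (fun t => Uq.phi D t.1 t.2.1 ((t.1 : ℤ) * t.2.2)) k) (luVal D) (luVal_separates D) _ _
    (fun Λ v hv => ?_) (fun Λ n hn => (coe_mem_luWeightSpace D N).1 hn) h
  obtain ⟨p, hp⟩ := luWeightSpace_pow hv
  refine ⟨p, ?_⟩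
  rintro (h | t)
  exacts [hp (Sum.inl h), hp (Sum.inr t)]

lemma iSup_weightSpaceCu_submodule (h : ⨆ ω, weightSpaceCu D M ω = ⊤) :
    ⨆ ω, weightSpaceCu D N ω = ⊤ :=
  iSup_eq_top_of_separates D N (Uq.k D) _ (weight_separates D Cu) _ _
    (fun _ _ hv => weightSpace_pow hv) (fun _ _ hn => (coe_mem_weightSpaceCu D N).1 hn) h

variable [Module ℂ M] [IsScalarTower ℂ Cu M] [IsScalarTower ℂ (UqCu D) M]

/-- The intersection of `N` with the lattice spanned by `W`. -/
def lattice (W : Submodule ℂ M) : Submodule laurentRing N :=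
  (Submodule.span laurentRing (W : Set M)).comap
    ((N.restrictScalars Cu).subtype.restrictScalars laurentRing)

/-- The weight `ω` part of the lattice in `N`. -/
def latticeWt (W : Submodule ℂ M) (ω : Module.Dual ℚ 𝔥) : Submodule laurentRing N :=
  lattice D N W ⊓ (weightSpaceCu D N ω).restrictScalars laurentRing

namespace IsGenerating

variable {D} {W : Submodule ℂ M} (hW : IsGenerating D W)

include hW

lemma fg_latticeWt (ω : Module.Dual ℚ 𝔥) : (latticeWt D N W ω).FG := by
  have h1 := isNoetherian_of_fg_of_noetherian _ (hW.fg_span_wtPart laurentRing ω)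
  refine Submodule.fg_of_fg_map_injective
    ((N.restrictScalars Cu).subtype.restrictScalars laurentRing) Subtype.val_injective ?_
  refine (isNoetherian_submodule.1 h1) _ ?_
  rintro _ ⟨n, hn, rfl⟩
  exact hW.mem_span_subalgebra laurentRing hn.1 ((coe_mem_weightSpaceCu D N).2 hn.2)

/-- Clearing denominators shows that the lattice spans the weight space over `ℂ(u)`. Being finitely
generated and torsion-free, it is free, and its basis is one of the weight space. -/
lemma exists_weight_basis (ω : Module.Dual ℚ 𝔥) :
    ∃ (d : ℕ) (b : Module.Basis (Fin d) Cu (weightSpaceCu D N ω)),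
      (∀ j, (b j : N) ∈ latticeWt D N W ω) ∧
      latticeWt D N W ω ≤ Submodule.span laurentRing (Set.range fun j => (b j : N)) := by
  refine exists_basis_of_lattice _ _ (hW.fg_latticeWt N ω) (fun x hx => hx.2) fun n hn => ?_
  have h1 := (coe_mem_weightSpaceCu D N).2 hn
  rw [hW.weightSpaceCu_eq_span] at h1
  obtain ⟨p, hp, hpn⟩ := exists_smul_mem_span_laurentRing h1
  exact ⟨p, hp, Submodule.span_mono inf_le_left hpn, Submodule.smul_mem _ (p : Cu) hn⟩

/-- A `U'_q(ĝ)`-submodule of an object of `Mod(U'_q(ĝ))` also has a generating subspace. -/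
lemma submodule : ∃ W' : Submodule ℂ N, IsGenerating D W' := by
  classical
  choose d b hb hb' using hW.exists_weight_basis N
  have hint : DirectSum.IsInternal (weightSpaceCu D N) :=
    DirectSum.isInternal_submodule_of_iSupIndep_of_iSup_eq_top (weightSpace_iSupIndep D _)
      (iSup_weightSpaceCu_submodule D N hW.iSup_weightSpaceCu)
  -- The generating subspace is the `ℂ`-span of this basis of `N`, assembled from the lattice bases
  -- of the weight spaces.
  let B := hint.collectedBasis b
  have hB : ∀ ω j, B ⟨ω, j⟩ = (b ω j : N) := fun ω j => by
    rw [hint.collectedBasis_coe]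
  let bs : Module.Dual ℚ 𝔥 → Set N := fun ω => Set.range fun j => (b ω j : N)
  have hbs : ∀ ω, bs ω ⊆ weightSpaceCu D N ω := by
    rintro ω _ ⟨j, rfl⟩
    exact (b ω j).2
  have hrange : ∀ (R : Type) [Semiring R] [Module R N],
      Set.range B ⊆ (⨆ ω, Submodule.span R (bs ω) : Submodule R N) := by
    rintro R _ _ _ ⟨⟨ω, j⟩, rfl⟩
    refine Submodule.mem_iSup_of_mem ω (Submodule.subset_span ⟨j, (hB ω j).symm⟩)
  let W' : Submodule ℂ N := Submodule.span ℂ (Set.range B)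
  have hbW : ∀ ω, bs ω ⊆ W' := by
    rintro ω _ ⟨j, rfl⟩
    exact Submodule.subset_span ⟨⟨ω, j⟩, hB ω j⟩
  have hsm : ∀ (ω : Module.Dual ℚ 𝔥) (c : ℂ) (v : N), v ∈ weightSpaceCu D N ω →
      c • v ∈ weightSpaceCu D N ω := by
    intro ω c v hv
    rw [← algebraMap_smul Cu c v]
    exact Submodule.smul_mem _ _ hv
  have hpart : ∀ ω, wtPart D W' ω = Submodule.span ℂ (bs ω) := by
    intro ω
    refine le_antisymm (fun v hv => ?_) (le_inf (Submodule.span_le.2 (hbW ω))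
      (Submodule.span_le.2 fun x hx => (mem_weightSpace_kActC D).2 (hbs ω hx)))
    exact mem_span_of_mem_weightSpaceCu D hsm hbs (hrange ℂ) hv.1
      ((mem_weightSpace_kActC D).1 hv.2)
  have hbot : ∀ ω, wtPart D W ω = ⊥ → wtPart D W' ω = ⊥ := by
    intro ω h
    rw [← hW.weightSpaceCu_eq_bot_iff] at h
    rw [Submodule.eq_bot_iff]
    intro n hn
    have := (coe_mem_weightSpaceCu D N).2 ((mem_weightSpace_kActC D).1 hn.2)
    rw [h, Submodule.mem_bot] at this
    exact Subtype.ext this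
  -- Once the new lattice is the intersection of `N` with the old one, its stability under `U_q(ĥ)`
  -- is immediate.
  have hlat : Submodule.span laurentRing (W' : Set N) = lattice D N W := by
    refine le_antisymm ?_ fun n hn => ?_
    · change Submodule.span laurentRing (Submodule.span ℂ (Set.range B) : Set N) ≤ _
      rw [Submodule.span_span_of_tower, Submodule.span_le]
      rintro _ ⟨⟨ω, j⟩, rfl⟩
      rw [hB]
      exact (hb ω j).1
    · have h1 : n ∈ ⨆ ω, weightSpaceCu D N ω := by
        rw [iSup_weightSpaceCu_submodule D N hW.iSup_weightSpaceCu]; trivial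
      obtain ⟨f, hf, rfl⟩ := (Submodule.mem_iSup_iff_exists_finsupp _ _).1 h1
      have h2 := weight_mem_of_sum_mem D (kActC D N) ((lattice D N W).restrictScalars ℂ)
        (fun h x hx => hW.lattice_stable (Uq.k D h)
          (Algebra.subset_adjoin (Or.inl ⟨h, rfl⟩)) x hx) f.support f
        (fun ω _ => (mem_weightSpace_kActC D).2 (hf ω)) hn
      refine sum_mem fun ω hω => ?_
      refine Submodule.span_mono (hbW ω) (hb' ω ⟨h2 ω hω, hf ω⟩)
  refine ⟨W', ?_, ?_, ?_, ?_⟩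
  · let BW : Module.Basis _ ℂ W' :=
      Module.Basis.span (B.linearIndependent.restrict_scalars' ℂ)
    -- The multiplication map carries the basis `1 ⊗ B` to `B`, hence it is an isomorphism.
    have h1 : LinearMap.liftBaseChange Cu W'.subtype =
        ((BW.baseChange Cu).equiv B (Equiv.refl _)).toLinearMap := by
      refine (BW.baseChange Cu).ext fun j => ?_
      rw [LinearEquiv.coe_coe, Module.Basis.equiv_apply, Module.Basis.baseChange_apply,
        LinearMap.liftBaseChange_one_tmul]
      exact congrArg Subtype.val
        (Module.Basis.span_apply (B.linearIndependent.restrict_scalars' ℂ) j)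
    rw [h1]
    exact LinearEquiv.bijective _
  · refine ⟨?_, ?_, ?_, ?_, ?_, ?_⟩
    · intro h w hw
      induction hw using Submodule.span_induction with
      | mem w hw =>
        obtain ⟨⟨ω, j⟩, rfl⟩ := hw
        have h1 : B ⟨ω, j⟩ ∈ weightSpace D (kActC D N) ω := by
          rw [hB]
          exact (mem_weightSpace_kActC D).2 (b ω j).2
        rw [h1 h]
        exact Submodule.smul_mem _ _ (Submodule.subset_span ⟨_, rfl⟩)
      | zero => rw [map_zero]; exact zero_mem _
      | add x y _ _ hx hy => rw [map_add]; exact add_mem hx hy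
      | smul c x _ hx => rw [map_smul]; exact Submodule.smul_mem _ _ hx
    · exact (weightSpace_iSupIndep D (kActC D N)).mono fun ω => inf_le_right
    · refine le_antisymm (iSup_le fun ω => inf_le_left) ?_
      change Submodule.span ℂ (Set.range B) ≤ ⨆ ω, wtPart D W' ω
      simp only [hpart]
      exact Submodule.span_le.2 (hrange ℂ)
    · intro ω
      change FiniteDimensional ℂ (wtPart D W' ω)
      rw [hpart]
      exact FiniteDimensional.span_of_finite ℂ (Set.finite_range _)
    · intro ω i
      obtain ⟨R, hR⟩ := hW.cartan.integrable ω i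
      exact ⟨R, fun r hr => ⟨hbot _ (hR r hr).1, hbot _ (hR r hr).2⟩⟩
    · obtain ⟨S, hS⟩ := hW.cartan.bounded
      exact ⟨S, fun ω hω => hS ω fun h => hω (hbot ω h)⟩
  · intro a ha n hn
    rw [hlat] at hn ⊢
    exact hW.lattice_stable a ha n hn
  · intro ω ε i r
    obtain ⟨S, F, hF⟩ := hW.exists_regular ω ε i r
    -- The coefficient maps take values in `M`. A `ℂ(u)`-linear retraction onto `N` corrects this
    -- without changing the sum, which already lies in `N`.
    obtain ⟨π, hπ⟩ := LinearMap.exists_leftInverse_of_injective (N.restrictScalars Cu).subtype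
      (Submodule.ker_subtype _)
    have hπ' : ∀ n : N, π (n : M) = n := fun n => DFunLike.congr_fun hπ n
    refine ⟨S, fun t => ((π ∘ₗ F t ∘ₗ (N.restrictScalars Cu).subtype).restrictScalars ℂ) ∘ₗ
      (wtPart D W' ω).subtype, fun m w => ?_⟩
    have h1 := hF m ((w : N) : M) ((coe_mem_weightSpaceCu D N).2
      ((mem_weightSpace_kActC D).1 w.2.2))
    have h2 := congrArg π h1
    rw [map_sum] at h2
    simp only [map_smul] at h2
    rw [← hπ' (incl D (Uq.x D ε i (r + (ε : ℤ) * m)) • (w : N))]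
    exact h2

end IsGenerating

variable {D} in
lemma InModUqCu.submodule (hM : InModUqCu D M) : InModUqCu D N := by
  obtain ⟨W, hW⟩ := hM.exists_generating
  exact ⟨hW.submodule N, luWeightSpace_iSupIndep D,
    iSup_luWeightSpace_submodule D N hM.lu_iSup⟩

end modules

end

/-! ## The `𝒜`-form generated by a vector -/

section

variable {I : Type*} [Fintype I] [DecidableEq I] {𝔥 : Type*} [AddCommGroup 𝔥] [Module ℚ 𝔥]
  (D : Datum I 𝔥)

/-- Linear independence of the simple roots gives a height function, which reads off the length of a
word from the weight it adds. -/
lemma Datum.exists_height : ∃ ρ : Module.Dual ℚ 𝔥 →ₗ[ℚ] ℚ, ∀ i, ρ (D.root i) = 1 := by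
  obtain ⟨ρ, hρ⟩ := LinearMap.exists_extend
    ((Finsupp.linearCombination ℚ fun _ : I => (1 : ℚ)) ∘ₗ D.root_indep.repr)
  refine ⟨ρ, fun i => ?_⟩
  have h := DFunLike.congr_fun hρ ⟨D.root i, Submodule.subset_span ⟨i, rfl⟩⟩
  rw [LinearMap.comp_apply, LinearMap.comp_apply, D.root_indep.repr_eq_single i _ rfl, Finsupp.linearCombination_single] at h
  simpa using h

lemma map_sum_roots {ρ : Module.Dual ℚ 𝔥 →ₗ[ℚ] ℚ} (hρ : ∀ i, ρ (D.root i) = 1) (l : List I) :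
    ρ (l.map D.root).sum = l.length := by
  induction l with
  | nil => simp
  | cons i l ih => simp [ih, hρ, add_comm]

lemma fg_of_le {M : Type*} [AddCommGroup M] [Module 𝒜 M] {E K : Submodule 𝒜 M} (hE : E.FG)
    (h : K ≤ E) : K.FG :=
  isNoetherian_submodule.1 (isNoetherian_of_fg_of_noetherian _ hE) K h

section modules

variable {M : Type*} [AddCommGroup M] [Module (UqCu D) M] [Module Cu M]
  [IsScalarTower Cu (UqCu D) M]

/-- The weight spaces as `𝒜`-submodules. -/
abbrev weightSpace𝒜 (M : Type*) [AddCommGroup M] [Module (UqCu D) M] [Module Cu M]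
    [IsScalarTower Cu (UqCu D) M] (ω : Module.Dual ℚ 𝔥) : Submodule 𝒜 M :=
  (weightSpaceCu D M ω).restrictScalars 𝒜

/-- The action of an element of `U_q(ĝ)`, as an `𝒜`-linear map. -/
def act𝒜 (M : Type*) [AddCommGroup M] [Module (UqCu D) M] [Module Cu M]
    [IsScalarTower Cu (UqCu D) M] (a : Uq D) : M →ₗ[𝒜] M :=
  (act D M a).restrictScalars 𝒜

/-- The `𝒜`-submodule generated by all `x^ε_{i, r} v`, for `v` in a given submodule. -/
def xSpan (ε : ℤˣ) (i : I) (F : Submodule 𝒜 M) : Submodule 𝒜 M :=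
  ⨆ r : ℤ, F.map (act𝒜 D M (Uq.x D ε i r))

lemma x_smul_mem_xSpan (ε : ℤˣ) (i : I) (r : ℤ) {F : Submodule 𝒜 M} {v : M} (hv : v ∈ F) :
    incl D (Uq.x D ε i r) • v ∈ xSpan D ε i F :=
  Submodule.mem_iSup_of_mem r ⟨v, hv, rfl⟩

/-- The `𝒜`-submodule generated by the `x^ε_{i₁, r₁} ⋯ x^ε_{iₙ, rₙ} v`, for a given sequence
of indices `i₁, …, iₙ`. -/
def xWord (ε : ℤˣ) (v : M) : List I → Submodule 𝒜 M
  | [] => Submodule.span 𝒜 {v}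
  | i :: l => xSpan D ε i (xWord ε v l)

lemma xAlg_smul_mem (ε : ℤˣ) (v : M) {a : Uq D} (ha : a ∈ xAlg D ε) :
    incl D a • v ∈ ⨆ l, xWord D ε v l := by
  have key : ∀ z ∈ ⨆ l, xWord D ε v l, incl D a • z ∈ ⨆ l, xWord D ε v l := by
    induction ha using Algebra.adjoin_induction with
    | mem a ha =>
      obtain ⟨⟨i, r⟩, rfl⟩ := ha
      have : (⨆ l, xWord D ε v l) ≤ (⨆ l, xWord D ε v l).comap (act𝒜 D M (Uq.x D ε i r)) :=
        iSup_le fun l z hz => Submodule.mem_iSup_of_mem (i :: l) (x_smul_mem_xSpan D ε i r hz)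
      exact this
    | algebraMap c =>
      intro z hz
      rw [AlgHom.commutes, IsScalarTower.algebraMap_apply ℂ Cu (UqCu D), algebraMap_smul]
      exact Submodule.smul_mem _ (algebraMap ℂ 𝒜 c) hz
    | add a b _ _ ha hb =>
      intro z hz
      rw [map_add, add_smul]
      exact add_mem (ha z hz) (hb z hz)
    | mul a b _ _ ha hb =>
      intro z hz
      rw [map_mul, mul_smul]
      exact ha _ (hb z hz)
  exact key v (Submodule.mem_iSup_of_mem [] (Submodule.mem_span_singleton_self v))

/-- A family of finitely generated `𝒜`-submodules of the weight spaces. -/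
def IsFGFamily (E : Module.Dual ℚ 𝔥 → Submodule 𝒜 M) : Prop :=
  ∀ ω, (E ω).FG ∧ E ω ≤ weightSpace𝒜 D M ω

lemma isFGFamily_biSup {ι : Type*} (s : Finset ι) (E : ι → Module.Dual ℚ 𝔥 → Submodule 𝒜 M)
    (hE : ∀ j ∈ s, IsFGFamily D (E j)) : IsFGFamily D fun ω => ⨆ j ∈ s, E j ω :=
  fun ω => ⟨Submodule.fg_biSup s _ fun j hj => (hE j hj ω).1,
    iSup₂_le fun j hj => (hE j hj ω).2⟩

variable [Module ℂ M] [IsScalarTower ℂ Cu M] [IsScalarTower ℂ (UqCu D) M]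

/-! ### Finite generation of the orbit in each weight. -/

namespace IsGenerating

variable {D} {W : Submodule ℂ M} (hW : IsGenerating D W)

include hW

lemma exists_weight_bound (ω : Module.Dual ℚ 𝔥) :
    ∃ n : ℕ, ∀ l : List I, weightSpaceCu D M (ω + (l.map D.root).sum) ≠ ⊥ → l.length ≤ n := by
  obtain ⟨ρ, hρ⟩ := D.exists_height
  obtain ⟨S, hS⟩ := hW.cartan.bounded
  refine ⟨S.sup fun lam => ⌈ρ (lam - ω)⌉₊, fun l hl => ?_⟩
  rw [Ne, hW.weightSpaceCu_eq_bot_iff] at hl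
  obtain ⟨lam, hlam, n, hn⟩ := hS _ hl
  refine le_trans ?_ (Finset.le_sup (f := fun lam => ⌈ρ (lam - ω)⌉₊) hlam)
  have h1 := congrArg ρ hn
  have h2 : 0 ≤ ρ (∑ i, n i • D.root i) := by
    rw [map_sum]
    refine Finset.sum_nonneg fun i _ => ?_
    rw [map_nsmul, hρ]
    positivity
  rw [← h1, ← sub_sub, map_sub, map_sum_roots D hρ, sub_nonneg] at h2
  exact_mod_cast h2.trans (Nat.le_ceil _)

lemma fg_xSpan {ω : Module.Dual ℚ 𝔥} (ε : ℤˣ) (i : I) {F : Submodule 𝒜 M} (hF : F.FG)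
    (hFω : F ≤ weightSpace𝒜 D M ω) : (xSpan D ε i F).FG := by
  obtain ⟨s, rfl⟩ := hF
  have hs : ∀ y : M, ∃ E : Submodule 𝒜 M, E.FG ∧
      (y ∈ s → ∀ r, incl D (Uq.x D ε i r) • y ∈ E) := by
    intro y
    by_cases hy : y ∈ s
    · obtain ⟨E, hE, hE'⟩ := hW.exists_fg_x_smul (hFω (Submodule.subset_span hy)) ε i
      exact ⟨E, hE, fun _ => hE'⟩
    · exact ⟨⊥, Submodule.fg_bot, fun h => absurd h hy⟩
  choose E hE hE' using hs
  refine fg_of_le (Submodule.fg_biSup s E fun y _ => hE y) (iSup_le fun r => ?_)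
  rw [Submodule.map_span, Submodule.span_le]
  rintro _ ⟨y, hy, rfl⟩
  exact Submodule.mem_iSup_of_mem y (Submodule.mem_iSup_of_mem hy (hE' y hy r))

/-- For a fixed sequence of indices `i`, each letter preserves finite generation although its mode
runs over all of `ℤ`. -/
lemma xWord_spec {ω : Module.Dual ℚ 𝔥} {v : M} (hv : v ∈ weightSpaceCu D M ω) (ε : ℤˣ)
    (l : List I) : (xWord D ε v l).FG ∧
      xWord D ε v l ≤ weightSpace𝒜 D M (ω + (ε : ℤ) • (l.map D.root).sum) := by
  induction l with
  | nil =>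
    refine ⟨Submodule.fg_span_singleton v, ?_⟩
    rw [List.map_nil, List.sum_nil, smul_zero, add_zero]
    change Submodule.span 𝒜 {v} ≤ _
    rwa [Submodule.span_singleton_le_iff_mem]
  | cons i l ih =>
    refine ⟨hW.fg_xSpan ε i ih.1 ih.2, iSup_le fun r => ?_⟩
    rintro _ ⟨y, hy, rfl⟩
    have h := x_smul_mem D (ih.2 hy) ε i r
    rw [List.map_cons, List.sum_cons, smul_add, add_comm _ (_ • List.sum _), ← add_assoc]
    exact h

/-- Positive words that are too long land in a zero weight space, and there are finitely many index
sequences of bounded length. -/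
lemma exists_finset_xAlg_pos {ω : Module.Dual ℚ 𝔥} {v : M} (hv : v ∈ weightSpaceCu D M ω) :
    ∃ t : Finset M, (∀ z ∈ t, ∃ μ, z ∈ weightSpaceCu D M μ) ∧
      ∀ a ∈ xAlg D 1, incl D a • v ∈ Submodule.span 𝒜 (t : Set M) := by
  classical
  obtain ⟨n, hn⟩ := hW.exists_weight_bound ω
  have hspec := hW.xWord_spec hv 1
  simp only [Units.val_one, one_smul] at hspec
  choose s hs using fun l => (hspec l).1
  have hfin := List.finite_length_le I n
  refine ⟨hfin.toFinset.biUnion s, fun z hz => ?_, fun a ha => ?_⟩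
  · obtain ⟨l, -, hl⟩ := Finset.mem_biUnion.1 hz
    refine ⟨_, (hspec l).2 ?_⟩
    rw [← hs]
    exact Submodule.subset_span hl
  · refine (iSup_le fun l => ?_ : (⨆ l, xWord D 1 v l) ≤ _) (xAlg_smul_mem D 1 v ha)
    by_cases hl : l.length ≤ n
    · rw [← hs]
      refine Submodule.span_mono fun z hz => ?_
      exact Finset.mem_biUnion.2 ⟨l, hfin.mem_toFinset.2 hl, hz⟩
    · have h0 : weightSpaceCu D M (ω + (l.map D.root).sum) = ⊥ := by
        by_contra h
        exact hl (hn l h)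
      intro z hz
      have h1 := (hspec l).2 hz
      rw [Submodule.restrictScalars_mem, h0, Submodule.mem_bot] at h1
      rw [h1]
      exact zero_mem _

lemma exists_finset_phiAlg {v : M} (hv : ∃ ω, v ∈ weightSpaceCu D M ω) :
    ∃ t : Finset M, (∀ z ∈ t, ∃ μ, z ∈ weightSpaceCu D M μ) ∧
      ∀ a ∈ phiAlg D, incl D a • v ∈ Submodule.span 𝒜 (t : Set M) := by
  obtain ⟨ω, hv⟩ := hv
  obtain ⟨E, hE, hE'⟩ := hW.exists_fg_cartan_smul hv
  obtain ⟨t, ht⟩ := fg_of_le hE (inf_le_left : E ⊓ weightSpace𝒜 D M ω ≤ E)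
  refine ⟨t, fun z hz => ⟨ω, ?_⟩, fun a ha => ?_⟩
  · have : z ∈ E ⊓ weightSpace𝒜 D M ω := by
      rw [← ht]; exact Submodule.subset_span hz
    exact this.2
  · rw [ht]
    exact ⟨hE' a ha, phiAlg_smul_mem D hv ha⟩

/-- Negative words may have any length, so finiteness holds only weight by weight: the target weight
fixes the length through the height function. -/
lemma exists_family_xAlg_neg {v : M} (hv : ∃ ω, v ∈ weightSpaceCu D M ω) :
    ∃ E, IsFGFamily D E ∧ ∀ a ∈ xAlg D (-1), incl D a • v ∈ (⨆ ω, E ω : Submodule 𝒜 M) := by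
  classical
  obtain ⟨ω, hv⟩ := hv
  obtain ⟨ρ, hρ⟩ := D.exists_height
  have hspec := hW.xWord_spec hv (-1)
  have hfin : ∀ lam, {l : List I | ω + ((-1 : ℤˣ) : ℤ) • (l.map D.root).sum = lam}.Finite := by
    intro lam
    refine (List.finite_length_le I ⌈ρ (ω - lam)⌉₊).subset fun l hl => ?_
    have h1 : ω - lam = (l.map D.root).sum := by
      rw [← show _ = lam from hl]
      simp
    change l.length ≤ _
    rw [h1, map_sum_roots D hρ, Nat.ceil_natCast]
  refine ⟨fun lam => ⨆ l ∈ (hfin lam).toFinset, xWord D (-1) v l, fun lam => ⟨?_, ?_⟩, ?_⟩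
  · exact Submodule.fg_biSup _ _ fun l _ => (hspec l).1
  · refine iSup₂_le fun l hl => ?_
    rw [← show _ = lam from (hfin lam).mem_toFinset.1 hl]
    exact (hspec l).2
  · intro a ha
    refine (iSup_le fun l => ?_ : (⨆ l, xWord D (-1) v l) ≤ _) (xAlg_smul_mem D (-1) v ha)
    refine le_trans ?_ (le_iSup _ (ω + ((-1 : ℤˣ) : ℤ) • (l.map D.root).sum))
    exact le_iSup₂_of_le l ((hfin _).mem_toFinset.2 rfl) le_rfl

lemma exists_family_weight {ω : Module.Dual ℚ 𝔥} {v : M} (hv : v ∈ weightSpaceCu D M ω) :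
    ∃ E, IsFGFamily D E ∧ ∀ a, incl D a • v ∈ (⨆ ω, E ω : Submodule 𝒜 M) := by
  classical
  obtain ⟨t₁, ht₁, h₁⟩ := hW.exists_finset_xAlg_pos hv
  -- The three factors of the triangular decomposition act in turn; generators are kept as weight
  -- vectors so that the next estimate applies to them.
  have h₂ : ∃ t : Finset M, (∀ z ∈ t, ∃ μ, z ∈ weightSpaceCu D M μ) ∧
      ∀ a ∈ phiAlg D, ∀ y ∈ Submodule.span 𝒜 (t₁ : Set M),
        incl D a • y ∈ Submodule.span 𝒜 (t : Set M) := by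
    have : ∀ y : M, ∃ t : Finset M, y ∈ t₁ → (∀ z ∈ t, ∃ μ, z ∈ weightSpaceCu D M μ) ∧
        ∀ a ∈ phiAlg D, incl D a • y ∈ Submodule.span 𝒜 (t : Set M) := by
      intro y
      by_cases hy : y ∈ t₁
      · obtain ⟨t, ht⟩ := hW.exists_finset_phiAlg (ht₁ y hy)
        exact ⟨t, fun _ => ht⟩
      · exact ⟨∅, fun h => absurd h hy⟩
    choose t ht using this
    refine ⟨t₁.biUnion t, fun z hz => ?_, fun a ha => ?_⟩
    · obtain ⟨y, hy, hz⟩ := Finset.mem_biUnion.1 hz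
      exact (ht y hy).1 z hz
    · have : Submodule.span 𝒜 (t₁ : Set M) ≤
          (Submodule.span 𝒜 (t₁.biUnion t : Set M)).comap (act𝒜 D M a) := by
        refine Submodule.span_le.2 fun y hy => ?_
        refine Submodule.span_mono (fun z hz => ?_) ((ht y hy).2 a ha)
        exact Finset.mem_coe.2 (Finset.mem_biUnion.2 ⟨y, hy, hz⟩)
      exact this
  obtain ⟨t₂, ht₂, h₂⟩ := h₂
  have h₃ : ∃ E, IsFGFamily D E ∧ ∀ a ∈ xAlg D (-1), ∀ y ∈ Submodule.span 𝒜 (t₂ : Set M),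
      incl D a • y ∈ (⨆ ω, E ω : Submodule 𝒜 M) := by
    have : ∀ y : M, ∃ E : Module.Dual ℚ 𝔥 → Submodule 𝒜 M, y ∈ t₂ → IsFGFamily D E ∧
        ∀ a ∈ xAlg D (-1), incl D a • y ∈ (⨆ ω, E ω : Submodule 𝒜 M) := by
      intro y
      by_cases hy : y ∈ t₂
      · obtain ⟨E, hE⟩ := hW.exists_family_xAlg_neg (ht₂ y hy)
        exact ⟨E, fun _ => hE⟩
      · exact ⟨fun _ => ⊥, fun h => absurd h hy⟩
    choose E hE using this
    refine ⟨_, isFGFamily_biSup D t₂ E fun y hy => (hE y hy).1, fun a ha => ?_⟩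
    have : Submodule.span 𝒜 (t₂ : Set M) ≤
        (⨆ ω, ⨆ y ∈ t₂, E y ω : Submodule 𝒜 M).comap (act𝒜 D M a) := by
      refine Submodule.span_le.2 fun y hy => ?_
      refine (iSup_mono fun ω => ?_ : (⨆ ω, E y ω) ≤ _) ((hE y hy).2 a ha)
      exact le_iSup₂_of_le y hy le_rfl
    exact this
  obtain ⟨E, hE, h₃⟩ := h₃
  refine ⟨E, hE, fun a => ?_⟩
  have ha : a ∈ Subalgebra.toSubmodule (xAlg D (-1)) * Subalgebra.toSubmodule (phiAlg D) *
      Subalgebra.toSubmodule (xAlg D 1) := by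
    rw [triangular]; trivial
  refine Submodule.mul_induction_on ha (fun b hb p hp => ?_) fun a b ha hb => ?_
  · rw [map_mul, mul_smul]
    have hz := h₁ p hp
    generalize incl D p • v = z at hz
    refine Submodule.mul_induction_on hb (fun n hn h hh => ?_) fun a b ha hb => ?_
    · rw [map_mul, mul_smul]
      exact h₃ n hn _ (h₂ h hh z hz)
    · rw [map_add, add_smul]; exact add_mem ha hb
  · rw [map_add, add_smul]; exact add_mem ha hb

lemma exists_family (v : M) :
    ∃ E, IsFGFamily D E ∧ ∀ a, incl D a • v ∈ (⨆ ω, E ω : Submodule 𝒜 M) := by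
  have hv : v ∈ ⨆ ω, weightSpaceCu D M ω := by rw [hW.iSup_weightSpaceCu]; trivial
  obtain ⟨f, hf, rfl⟩ := (Submodule.mem_iSup_iff_exists_finsupp _ _).1 hv
  choose E hE hE' using fun ω => hW.exists_family_weight (hf ω)
  refine ⟨_, isFGFamily_biSup D f.support E fun ω _ => hE ω, fun a => ?_⟩
  rw [Finsupp.sum, Finset.smul_sum]
  refine sum_mem fun ω hω => ?_
  refine (iSup_mono fun ω' => ?_ : (⨆ ω', E ω ω') ≤ _) (hE' ω a)
  exact le_iSup₂_of_le ω hω le_rfl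

end IsGenerating

variable {D}

lemma smul_mem_of_mem_UqA {K : Submodule 𝒜 M} {v : M} (h : ∀ a, incl D a • v ∈ K)
    {a : UqCu D} (ha : a ∈ UqA D) : a • v ∈ K := by
  obtain ⟨t, rfl⟩ := ha
  induction t using TensorProduct.induction_on with
  | zero => rw [map_zero, zero_smul]; exact zero_mem _
  | tmul c b =>
    have h1 : (Algebra.TensorProduct.map 𝒜.val (AlgHom.id ℂ (Uq D))) (c ⊗ₜ b) =
        (c : Cu) • incl D b := by
      simp [incl, TensorProduct.smul_tmul']
    change (Algebra.TensorProduct.map 𝒜.val (AlgHom.id ℂ (Uq D))) (c ⊗ₜ b) • v ∈ K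
    rw [h1, smul_assoc]
    exact K.smul_mem c (h b)
  | add x y hx hy =>
    rw [map_add, add_smul]
    exact add_mem hx hy

lemma smul_mem_span_Cu {v : M} {K : Submodule Cu M} (h : ∀ a, incl D a • v ∈ K) (a : UqCu D) :
    a • v ∈ K := by
  induction a using TensorProduct.induction_on with
  | zero => rw [zero_smul]; exact zero_mem _
  | tmul c b =>
    have h1 : c ⊗ₜ b = c • incl D b := by simp [incl, TensorProduct.smul_tmul']
    rw [h1, smul_assoc]
    exact K.smul_mem c (h b)
  | add x y hx hy =>
    rw [add_smul]
    exact add_mem hx hy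

/-- The `U^u_q(ĝ)`-submodule generated by a generator of an object of `Mod(U'_q(ĝ))` is
an `𝒜`-form. -/
lemma isAForm_of_generator (hM : InModUqCu D M) (g : M)
    (hg : Submodule.span (UqCu D) {g} = ⊤) (L : Submodule 𝒜 M)
    (hL : ∀ x, x ∈ L ↔ ∃ a ∈ UqA D, a • g = x) : IsAForm D M L := by
  obtain ⟨W, hW⟩ := hM.exists_generating
  refine ⟨?_, ?_, fun lam => ?_⟩
  · intro a ha x hx
    obtain ⟨b, hb, rfl⟩ := (hL x).1 hx
    exact (hL _).2 ⟨a * b, mul_mem ha hb, mul_smul a b g⟩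
  · rw [eq_top_iff]
    intro x _
    have hx : x ∈ Submodule.span (UqCu D) {g} := by rw [hg]; trivial
    obtain ⟨a, rfl⟩ := Submodule.mem_span_singleton.1 hx
    exact smul_mem_span_Cu (fun b => Submodule.subset_span
      ((hL _).2 ⟨_, incl_mem_UqA D b, rfl⟩)) a
  · obtain ⟨E, hE, hE'⟩ := hW.exists_family g
    -- The part of `L` of weight `lam` lies in `E lam`, and `𝒜` is noetherian.
    refine fg_of_le (hE lam).1 fun x hx => ?_
    obtain ⟨a, ha, rfl⟩ := (hL x).1 hx.1
    have h1 := mem_span_of_mem_weightSpaceCu D (R := 𝒜) (W' := fun ω => E ω)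
      (W := (⨆ ω, E ω : Submodule 𝒜 M)) (ω := lam) (v := a • g)
      (fun ω r _ hv => Submodule.smul_mem (weightSpaceCu D M ω) (r : Cu) hv)
      (fun ω => (hE ω).2) (by simp only [Submodule.span_eq]; exact subset_rfl)
      (Submodule.subset_span (smul_mem_of_mem_UqA hE' ha)) hx.2
    rwa [Submodule.span_eq] at h1

end modules

end

/-! ## The specialization -/

section

variable {I : Type*} [Fintype I] [DecidableEq I] {𝔥 : Type*} [AddCommGroup 𝔥] [Module ℚ 𝔥]
  {D : Datum I 𝔥} {M : Type*} [AddCommGroup M] [Module (UqCu D) M] [Module Cu M]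
  [IsScalarTower Cu (UqCu D) M] {L : Submodule 𝒜 M} (hL : IsAForm D M L)

namespace Spec1

lemma mk_surjective : Function.Surjective (mk D hL) := Submodule.mkQ_surjective _

lemma complex_smul_mk (c : ℂ) (x : L) : c • mk D hL x = mk D hL (algebraMap ℂ 𝒜 c • x) := by
  change algebraMap ℂ (Uq D) c • mk D hL x = _
  rw [smul_mk]
  refine congrArg (mk D hL) (Subtype.ext ?_)
  change incl D (algebraMap ℂ (Uq D) c) • (x : M) = algebraMap ℂ Cu c • (x : M)
  rw [AlgHom.commutes, IsScalarTower.algebraMap_apply ℂ Cu (UqCu D), algebraMap_smul]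

/-- In the specialization `f` acts through its value at `u = 1`, so `𝒜`-generators become
`ℂ`-generators. -/
lemma mk_smul_exists (f : 𝒜) (x : L) : ∃ c : ℂ, mk D hL (f • x) = c • mk D hL x := by
  obtain ⟨c, y, rfl⟩ := 𝒜_exists_eval f
  refine ⟨c, ?_⟩
  rw [complex_smul_mk, add_smul, map_add, add_eq_left]
  refine (Submodule.Quotient.mk_eq_zero _).2 ⟨y • x, ?_⟩
  rw [mul_smul]
  rfl

/-- The weight `ω` part of an `𝒜`-form. -/
def wtForm (L : Submodule 𝒜 M) (ω : Module.Dual ℚ 𝔥) : Submodule 𝒜 L :=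
  (weightSpace𝒜 D M ω).comap L.subtype

include hL in
lemma fg_wtForm (ω : Module.Dual ℚ 𝔥) : (wtForm (D := D) L ω).FG := by
  refine Submodule.fg_of_fg_map_injective L.subtype Subtype.val_injective ?_
  rw [wtForm, Submodule.map_comap_subtype]
  exact hL.fg ω

/-- The action of the `k_h` on the specialization. -/
abbrev κ (h : 𝔥) : Module.End ℂ (Spec1 D hL) := Algebra.lsmul ℂ ℂ (Spec1 D hL) (Uq.k D h)

lemma mk_mem_weightSpace {ω : Module.Dual ℚ 𝔥} {x : L} (hx : x ∈ wtForm (D := D) L ω) :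
    mk D hL x ∈ weightSpace D (κ hL) ω := by
  intro h
  change Uq.k D h • mk D hL x = D.qpow (ω h) • mk D hL x
  rw [smul_mk, complex_smul_mk]
  exact congrArg (mk D hL) (Subtype.ext (hx h))

variable [Module ℂ M] [IsScalarTower ℂ Cu M] [IsScalarTower ℂ (UqCu D) M]

include hL in
-- The form is stable under the `k_h` and under `ℂ`, over which the weight components are already
-- separated; no division by elements of `𝒜` occurs.
lemma exists_components {W : Submodule ℂ M} (hW : IsGenerating D W) (x : L) :
    ∃ (S : Finset (Module.Dual ℚ 𝔥)) (f : Module.Dual ℚ 𝔥 → L),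
      (∀ ω, f ω ∈ wtForm (D := D) L ω) ∧ ∑ ω ∈ S, f ω = x := by
  have hx : (x : M) ∈ ⨆ ω, weightSpaceCu D M ω := by rw [hW.iSup_weightSpaceCu]; trivial
  obtain ⟨f, hf, hsum⟩ := (Submodule.mem_iSup_iff_exists_finsupp _ _).1 hx
  have h2 := weight_mem_of_sum_mem D (kActC D M) (L.restrictScalars ℂ)
    (fun h y hy => hL.stable _ (incl_mem_UqA D _) y hy) f.support f
    (fun ω _ => (mem_weightSpace_kActC D).2 (hf ω)) (by
      change f.sum (fun _ y => y) ∈ L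
      rw [hsum]
      exact x.2)
  have h3 : ∀ ω, f ω ∈ L := by
    intro ω
    by_cases hω : ω ∈ f.support
    · exact h2 ω hω
    · rw [Finsupp.notMem_support_iff.1 hω]
      exact zero_mem _
  refine ⟨f.support, fun ω => ⟨f ω, h3 ω⟩, hf, Subtype.ext ?_⟩
  rw [AddSubmonoidClass.coe_finsetSum]
  exact hsum

/-- The components of any lift specialize to weight vectors of the same weights, so independence at
`u = 1` lets the component of weight `ω` serve as the lift. -/
lemma exists_of_mem_weightSpace {W : Submodule ℂ M} (hW : IsGenerating D W)
    {ω : Module.Dual ℚ 𝔥} {z : Spec1 D hL} (hz : z ∈ weightSpace D (κ hL) ω) :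
    ∃ x ∈ wtForm (D := D) L ω, mk D hL x = z := by
  obtain ⟨x, rfl⟩ := mk_surjective hL z
  obtain ⟨S, f, hf, rfl⟩ := exists_components hL hW x
  have h := eq_component_of_mem_weightSpace D (κ hL) S (fun ω => mk D hL (f ω))
    (fun ω _ => mk_mem_weightSpace hL (hf ω)) hz (map_sum _ _ _).symm
  by_cases hω : ω ∈ S
  · exact ⟨f ω, hf ω, (h.1 hω).symm⟩
  · exact ⟨0, zero_mem _, by rw [h.2 hω, map_zero]⟩

lemma weightSpace_eq_bot {W : Submodule ℂ M} (hW : IsGenerating D W) {ω : Module.Dual ℚ 𝔥}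
    (h : wtPart D W ω = ⊥) : weightSpace D (κ hL) ω = ⊥ := by
  rw [← hW.weightSpaceCu_eq_bot_iff] at h
  rw [Submodule.eq_bot_iff]
  intro z hz
  obtain ⟨x, hx, rfl⟩ := exists_of_mem_weightSpace hL hW hz
  have h1 : (x : M) ∈ weightSpaceCu D M ω := hx
  rw [h, Submodule.mem_bot] at h1
  rw [show x = 0 from Subtype.ext h1, map_zero]

/-- The specialization of an `𝒜`-form is an object of `Mod(U_q(ĝ))`. -/
lemma inModUq {W : Submodule ℂ M} (hW : IsGenerating D W) : InModUq D (Spec1 D hL) := by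
  have htop : ∀ ω, (⊤ : Submodule ℂ (Spec1 D hL)) ⊓ weightSpace D (κ hL) ω =
      weightSpace D (κ hL) ω := fun ω => top_inf_eq _
  refine ⟨fun _ _ _ => trivial, ?_, ?_, fun ω => ?_, fun ω i => ?_, ?_⟩
  · simp only [htop]
    exact weightSpace_iSupIndep D (κ hL)
  · simp only [htop]
    rw [eq_top_iff]
    intro z _
    obtain ⟨x, rfl⟩ := mk_surjective hL z
    obtain ⟨S, f, hf, rfl⟩ := exists_components hL hW x
    rw [map_sum]
    exact sum_mem fun ω _ => Submodule.mem_iSup_of_mem ω (mk_mem_weightSpace hL (hf ω))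
  · rw [htop]
    obtain ⟨s, hs⟩ := fg_wtForm hL ω
    have hle : weightSpace D (κ hL) ω ≤ Submodule.span ℂ (mk D hL '' (s : Set L)) := by
      intro z hz
      obtain ⟨x, hx, rfl⟩ := exists_of_mem_weightSpace hL hW hz
      rw [← hs] at hx
      induction hx using Submodule.span_induction with
      | mem x hx => exact Submodule.subset_span ⟨x, hx, rfl⟩
      | zero => rw [map_zero]; exact zero_mem _
      | add x y hx' hy' hx hy =>
        rw [map_add]
        refine add_mem (hx ?_) (hy ?_)
        · exact mk_mem_weightSpace hL (hs ▸ hx')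
        · exact mk_mem_weightSpace hL (hs ▸ hy')
      | smul c x hx' hx =>
        obtain ⟨d, hd⟩ := mk_smul_exists hL c x
        rw [hd]
        exact Submodule.smul_mem _ d (hx (mk_mem_weightSpace hL (hs ▸ hx')))
    have := FiniteDimensional.span_of_finite ℂ (s.finite_toSet.image (mk D hL))
    exact Submodule.finiteDimensional_of_le hle
  · obtain ⟨R, hR⟩ := hW.cartan.integrable ω i
    refine ⟨R, fun r hr => ?_⟩
    rw [htop, htop]
    exact ⟨weightSpace_eq_bot hL hW (hR r hr).1, weightSpace_eq_bot hL hW (hR r hr).2⟩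
  · obtain ⟨S, hS⟩ := hW.cartan.bounded
    refine ⟨S, fun ω hω => hS ω fun h => hω ?_⟩
    rw [htop]
    exact weightSpace_eq_bot hL hW h

/-- The specialization of an `𝒜`-form of a nonzero object of `Mod(U'_q(ĝ))` is nonzero. -/
lemma nontrivial {W : Submodule ℂ M} (hW : IsGenerating D W) [Nontrivial M] :
    Nontrivial (Spec1 D hL) := by
  by_contra hcon
  rw [not_nontrivial_iff_subsingleton] at hcon
  have hdiv : ∀ x : L, ∃ y : L, uSubOne • y = x := by
    intro x
    obtain ⟨y, hy⟩ := (Submodule.Quotient.mk_eq_zero _).1 (Subsingleton.elim (mk D hL x) 0)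
    exact ⟨y, hy⟩
  have hbot : ∀ ω, wtForm (D := D) L ω = ⊥ := by
    intro ω
    -- If the specialization vanished, `L` would be divisible by `u - 1`. So would each weight part,
    -- because `u - 1` is an invertible scalar on weight spaces, and Nakayama's lemma applies to
    -- these finitely generated parts rather than to `L`.
    refine Submodule.eq_bot_of_le_smul_of_le_jacobson_bot (Ideal.span {uSubOne}) _
      (fg_wtForm hL ω) (fun x hx => ?_) span_uSubOne_le_jacobson
    obtain ⟨y, rfl⟩ := hdiv x
    refine Submodule.smul_mem_smul (Ideal.mem_span_singleton_self _) ?_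
    have h1 := Submodule.smul_mem (weightSpaceCu D M ω) (uSubOne : Cu)⁻¹ hx
    change (uSubOne : Cu)⁻¹ • (uSubOne : Cu) • (y : M) ∈ _ at h1
    rwa [smul_smul, inv_mul_cancel₀ uSubOne_ne_zero, one_smul] at h1
  have hzero : L = ⊥ := by
    rw [Submodule.eq_bot_iff]
    intro x hx
    obtain ⟨S, f, hf, hsum⟩ := exists_components hL hW ⟨x, hx⟩
    have h0 : ∀ ω, f ω = 0 := fun ω => by
      have := hf ω
      rwa [hbot, Submodule.mem_bot] at this
    simp only [h0, Finset.sum_const_zero] at hsum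
    exact (congrArg Subtype.val hsum).symm
  have h1 := hL.span_eq
  rw [hzero] at h1
  simp at h1

lemma span_mk_eq_top {g : M} (hg : g ∈ L) (h : ∀ x ∈ L, ∃ a ∈ UqA D, a • g = x) :
    Submodule.span (Uq D) {mk D hL ⟨g, hg⟩} = ⊤ := by
  set K := Submodule.span (Uq D) {mk D hL ⟨g, hg⟩} with hK
  -- The preimage of `K` is an `𝒜`-submodule because `𝒜` acts on classes through `ℂ`; it contains
  -- `U_q(ĝ).g`, hence all of `U^u_q(ĝ).g`.
  let K' : Submodule 𝒜 L :=
    { carrier := {x | mk D hL x ∈ K}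
      zero_mem' := by rw [Set.mem_ofPred_eq, map_zero]; exact zero_mem _
      add_mem' := by
        intro x y hx hy
        rw [Set.mem_ofPred_eq, map_add]
        exact add_mem hx hy
      smul_mem' := by
        intro c x hx
        obtain ⟨d, hd⟩ := mk_smul_exists hL c x
        rw [Set.mem_ofPred_eq, hd]
        exact K.smul_mem (algebraMap ℂ (Uq D) d) hx }
  have hgen : ∀ b : Uq D, incl D b • g ∈ K'.map L.subtype := by
    intro b
    refine ⟨actForm D hL b ⟨g, hg⟩, ?_, rfl⟩
    change mk D hL _ ∈ K
    rw [← smul_mk]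
    exact K.smul_mem b (Submodule.mem_span_singleton_self _)
  rw [eq_top_iff]
  intro z _
  obtain ⟨⟨x, hx⟩, rfl⟩ := mk_surjective hL z
  obtain ⟨a, ha, rfl⟩ := h x hx
  obtain ⟨y, hy, hyx⟩ := smul_mem_of_mem_UqA hgen ha
  rw [← show y = ⟨a • g, hx⟩ from Subtype.ext hyx]
  exact hy

end Spec1

lemma span_cycGen_eq_top {V : Type*} [AddCommGroup V] [Module (UqCu D) V] (v : V) :
    Submodule.span (UqCu D) {cycGen D v} = ⊤ := by
  rw [eq_top_iff]
  rintro ⟨x, hx⟩ -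
  obtain ⟨a, rfl⟩ := Submodule.mem_span_singleton.1 hx
  exact Submodule.mem_span_singleton.2 ⟨a, rfl⟩

end

end QAff

end

theorem theorem4p6 {I : Type*} [Fintype I] [DecidableEq I]
    {𝔥 : Type*} [AddCommGroup 𝔥] [Module ℚ 𝔥] (D : QAff.Datum I 𝔥)
    {V : Type*} [AddCommGroup V] [Module (QAff.UqCu D) V]
    [Module QAff.Cu V] [IsScalarTower QAff.Cu (QAff.UqCu D) V]
    [Module ℂ V] [IsScalarTower ℂ QAff.Cu V] [IsScalarTower ℂ (QAff.UqCu D) V]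
    (hV : QAff.InModUqCu D V) (v : V) (hv : v ≠ 0) :
    QAff.InModUqCu D (QAff.cyc D v) ∧
    ∃ hL : QAff.IsAForm D (QAff.cyc D v) (QAff.cycForm D v),
      QAff.InModUq D (QAff.Spec1 D hL) ∧
      Nontrivial (QAff.Spec1 D hL) ∧
      Submodule.span (QAff.Uq D) {QAff.Spec1.mk D hL (QAff.cycFormGen D v)} = ⊤ := by
  have hN := hV.submodule (QAff.cyc D v)
  have hL : QAff.IsAForm D (QAff.cyc D v) (QAff.cycForm D v) :=
    QAff.isAForm_of_generator hN (QAff.cycGen D v) (QAff.span_cycGen_eq_top v) _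
      fun _ => Iff.rfl
  obtain ⟨W, hW⟩ := hN.exists_generating
  have : Nontrivial (QAff.cyc D v) :=
    ⟨⟨QAff.cycGen D v, 0, fun h => hv (congrArg Subtype.val h)⟩⟩
  exact ⟨hN, hL, QAff.Spec1.inModUq hL hW, QAff.Spec1.nontrivial hL hW,
    QAff.Spec1.span_mk_eq_top hL _ fun _ hx => hx⟩
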